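/- **Setting.** Let $d,q\in\mathbb N$, let $\Lambda\subset\mathbb Z^d$ be finite, and let $\mathcal H_\Lambda=(\mathbb C^q)^{\otimes\Lambda}$. For $S\subset\Lambda$ let $\mathcal B_S$ be the algebra of operators $1_{\Lambda\setminus S}\otimes O_S$. A potential $Z=(Z_S)$ is a family with $Z_S\in\mathcal B_S$, indexed by the nonempty subsets $S\subset\Lambda$ that are connected by nearest-neighbour adjacency; the associated operator is $\sum_S Z_S$, again written $Z$. A potential is called Hermitian (anti-Hermitian, periodic, ...) if every $Z_S$ is. For time-dependent potentials and $\kappa>0$ set $$\|Z\|_\kappa=\sup_{x\in\Lambda}\ \sum_{S\ni x}e^{\kappa|S|}\,\sup_{t}\|Z_S(t)\| .$$ For potentials $Q,Z$ set $(\mathrm{ad}_Q Z)_S=\sum_{S_1\cup S_2=S}[Q_{S_1},Z_{S_2}]$ and define the potential $e^{\mathrm{ad}_Q}Z$ by the exponential series. Let $T>0$, $\nu=2\pi/T$, and let $H(t)$ be a $T$-periodic Hermitian potential, measurable and bounded in $t\in\mathbb R$. Put $D_S=\frac1T\int_0^T H_S(t)\,dt$ and $V_S(t)=H_S(t)-D_S$,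 and let $U(t)$ be the unitary family generated by $H$, that is, $U(t)=1-i\int_0^t H(s)U(s)\,ds$. For $\kappa_0>0$ set $$\nu_0=\frac{54\pi}{\kappa_0^2}\bigl(\|D\|_{\kappa_0}+2\|V\|_{\kappa_0}\bigr),\qquad n_*=\Bigl\lfloor\frac{\nu/\nu_0}{(1+\ln(\nu/\nu_0))^3}\Bigr\rfloor-2,\qquad \kappa_{n_*}=\frac{\kappa_0}{1+\ln(n_*+1)} .$$ **Theorem.** There is a numerical constant $C>0$, independent of $d,q,\Lambda,T,\kappa_0,H$, such that the following holds whenever $\nu_0>0$, $\nu\ge 9\pi\|V\|_{\kappa_0}/\kappa_0$, $\nu\ge\nu_0$ and $n_*\ge1$. There are Hermitian potentials $\widehat D$ and $\widehat V(t)$, with $\widehat D$ time-independent and $\widehat V$ $T$-periodic, measurable and bounded, and anti-Hermitian, continuous, $T$-periodic potentials $A_0(t),\dots,A_{n_*}(t)$ with $A_j(0)=0$, such that, with the unitaries $Y(t)=e^{A_{n_*}(t)}\cdots e^{A_0(t)}$: 1. $Y(t)$ is $T$-periodic, $Y(mT)=1$ for all $m\in\mathbb Z$, and $\widehat U(t)=Y(t)U(t)$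 is the unitary family generated by $\widehat D+\widehat V(t)$, that is, $\widehat U(t)=1-i\int_0^t(\widehat D+\widehat V(s))\widehat U(s)\,ds$. 2. $\|\widehat D-D\|_{\kappa_{n_*}}\le C\,(\nu_0/\nu)\,\|V\|_{\kappa_0}$ and $\|\widehat V\|_{\kappa_{n_*}}\le C\,(2/3)^{n_*}\,\|V\|_{\kappa_0}$. 3. For every (possibly time-dependent) potential $Z$, the potential $e^{\mathrm{ad}_{A_{n_*}(t)}}\cdots e^{\mathrm{ad}_{A_0(t)}}Z$ is a potential for the operator $Y(t)ZY^*(t)$, and with this interpretation $\|YZY^*-Z\|_{\kappa_{n_*}}\le C\,(\nu_0/\nu)\,\|Z\|_{\kappa_0}$. -/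

import Mathlib

open scoped ENNReal
open MeasureTheory

namespace DrivenSpin

/-- Nearest-neighbour adjacency on the lattice `ℤ^d`. -/
def latticeGraph (d : ℕ) : SimpleGraph (Fin d → ℤ) where
  Adj x y := ∑ i, |x i - y i| = 1
  symm := ⟨fun x y h => by
    rw [← h]
    exact Finset.sum_congr rfl fun i _ => abs_sub_comm _ _⟩
  loopless := ⟨fun x h => by simp at h⟩

section Setup

variable {d : ℕ}

/-- Spin configurations on the finite volume `Λ`, with `q` states per site. -/
abbrev Config (q : ℕ) (Λ : Finset (Fin d → ℤ)) : Type := Λ → Fin q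

/-- The Hilbert space `(ℂ^q)^{⊗Λ}`, written in its product orthonormal basis. -/
abbrev Hilb (q : ℕ) (Λ : Finset (Fin d → ℤ)) : Type := EuclideanSpace ℂ (Config q Λ)

/-- The algebra of operators on `(ℂ^q)^{⊗Λ}`, with the operator norm. -/
abbrev Op (q : ℕ) (Λ : Finset (Fin d → ℤ)) : Type := Hilb q Λ →L[ℂ] Hilb q Λ

/-- The nonempty connected subsets of `Λ`. -/
abbrev ConnSet (Λ : Finset (Fin d → ℤ)) : Type :=
  {S : Finset Λ //
    (((latticeGraph d).comap (Subtype.val : Λ → (Fin d → ℤ))).induce (S : Set Λ)).Connected}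

noncomputable instance (Λ : Finset (Fin d → ℤ)) : Fintype (ConnSet Λ) := Fintype.ofFinite _

/-- The configuration that equals `ξ` on `S` and `η` off `S`. -/
def replaceOn {q : ℕ} {Λ : Finset (Fin d → ℤ)} (S : Finset Λ) (η : Config q Λ)
    (ξ : S → Fin q) : Config q Λ :=
  fun x => if h : x ∈ S then ξ ⟨x, h⟩ else η x

/-- `O` is of the form `1_{Λ∖S} ⊗ O_S`; here `M` is the matrix of `O_S` on `(ℂ^q)^{⊗S}`. -/
def ActsWithin {q : ℕ} {Λ : Finset (Fin d → ℤ)} (S : Finset Λ) (O : Op q Λ) : Prop :=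
  ∃ M : (S → Fin q) → (S → Fin q) → ℂ, ∀ (ψ : Hilb q Λ) (η : Config q Λ),
    (O ψ) η = ∑ ξ : S → Fin q, M (fun x => η x) ξ * ψ (replaceOn S η ξ)

/-- A family of operators indexed by the connected subsets of `Λ`. It is an interaction potential
when it satisfies `IsLocal`. -/
abbrev Potential (q : ℕ) (Λ : Finset (Fin d → ℤ)) : Type := ConnSet Λ → Op q Λ

variable {q : ℕ} {Λ : Finset (Fin d → ℤ)}

/-- `Z_S` acts within `S`, for every `S`. -/
def IsLocal (Z : Potential q Λ) : Prop := ∀ S : ConnSet Λ, ActsWithin S.1 (Z S)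

/-- The operator `∑_S Z_S` of a potential. -/
noncomputable def toOp (Z : Potential q Λ) : Op q Λ := ∑ S, Z S

open scoped Classical in
/-- The commutator of potentials, `(ad_Q Z)_S = ∑_{S₁ ∪ S₂ = S} [Q_{S₁}, Z_{S₂}]`. -/
noncomputable def ad (Q Z : Potential q Λ) : Potential q Λ := fun S =>
  ∑ S₁ : ConnSet Λ, ∑ S₂ : ConnSet Λ,
    if S₁.1 ∪ S₂.1 = S.1 then Q S₁ * Z S₂ - Z S₂ * Q S₁ else 0

/-- The potential `e^{ad_Q} Z`, through the power series. -/
noncomputable def expAd (Q Z : Potential q Λ) : Potential q Λ := fun S =>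
  ∑' m : ℕ, ((m.factorial : ℂ)⁻¹) • ((ad Q)^[m] Z) S

/-- The operator `e^{A_n} ⋯ e^{A_0}`. -/
noncomputable def expProd (A : ℕ → Potential q Λ) : ℕ → Op q Λ
  | 0 => NormedSpace.exp (toOp (A 0))
  | n + 1 => NormedSpace.exp (toOp (A (n + 1))) * expProd A n

/-- The potential `e^{ad_{A_n}} ⋯ e^{ad_{A_0}} Z`. -/
noncomputable def expAdProd (A : ℕ → Potential q Λ) (Z : Potential q Λ) : ℕ → Potential q Λ
  | 0 => expAd (A 0) Z
  | n + 1 => expAd (A (n + 1)) (expAdProd A Z n)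

open scoped Classical in
/-- The norm `‖Z‖_κ = sup_x ∑_{S ∋ x} e^{κ|S|} sup_t ‖Z_S(t)‖` of a time-dependent potential. -/
noncomputable def potNorm (κ : ℝ) (Z : ℝ → Potential q Λ) : ℝ≥0∞ :=
  ⨆ x : Λ, ∑ S : ConnSet Λ with x ∈ S.1,
    ENNReal.ofReal (Real.exp (κ * S.1.card)) * ⨆ t : ℝ, ‖Z t S‖ₑ

/-- A `T`-periodic Hermitian potential, measurable and bounded in time. -/
structure IsPeriodicHermitian (T : ℝ) (H : ℝ → Potential q Λ) : Prop where
  isLocal : ∀ t, IsLocal (H t)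
  hermitian : ∀ t S, IsSelfAdjoint (H t S)
  periodic : Function.Periodic H T
  measurable : ∀ S, AEStronglyMeasurable (fun t => H t S) volume
  bounded : ∃ M : ℝ, ∀ t S, ‖H t S‖ ≤ M

/-- The static part `D_S = (1/T) ∫_0^T H_S(t) dt`. -/
noncomputable def staticPart (T : ℝ) (H : ℝ → Potential q Λ) : Potential q Λ := fun S =>
  (1 / T : ℝ) • ∫ t in (0 : ℝ)..T, H t S

/-- The driving part `V_S(t) = H_S(t) - D_S`. -/
noncomputable def drivePart (T : ℝ) (H : ℝ → Potential q Λ) : ℝ → Potential q Λ := fun t S =>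
  H t S - staticPart T H S

/-- `U` is the unitary family generated by `H`: `U(t) = 1 - i ∫_0^t H(s) U(s) ds`. -/
structure IsGeneratedBy (H : ℝ → Op q Λ) (U : ℝ → Op q Λ) : Prop where
  continuous : Continuous U
  isUnitary : ∀ t, U t ∈ unitary (Op q Λ)
  eq_integral : ∀ t, U t = 1 - Complex.I • ∫ s in (0 : ℝ)..t, H s * U s

/-- The energy scale `ν₀ = (54π/κ₀²) (‖D‖_{κ₀} + 2‖V‖_{κ₀})`. -/
noncomputable def nuZero (κ₀ T : ℝ) (H : ℝ → Potential q Λ) : ℝ :=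
  54 * Real.pi / κ₀ ^ 2 *
    ((potNorm κ₀ fun _ => staticPart T H).toReal + 2 * (potNorm κ₀ (drivePart T H)).toReal)

end Setup

/-- `⌊x / (1 + ln x)³⌋ - 2`, to be used at `x = ν/ν₀`. -/
noncomputable def nStar (x : ℝ) : ℤ := ⌊x / (1 + Real.log x) ^ 3⌋ - 2

/-- The decay rate `κ_n = κ₀ / (1 + ln (n + 1))`. -/
noncomputable def decayRate (κ₀ : ℝ) (n : ℕ) : ℝ := κ₀ / (1 + Real.log (n + 1))

end DrivenSpin

open DrivenSpin

/-! The drive is removed order by order by changes of frame. Let $H=D+V(t)$ with $V$ periodic of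
mean zero, and put $A(t)=i\int_0^tV$. In the frame rotated by $e^A$ the Hamiltonian is
$e^{\mathrm{ad}_A}H-\varphi(\mathrm{ad}_A)V$ with $\varphi(x)=(e^x-1)/x$, that is,
$D+(e^{\mathrm{ad}_A}-1)D+(e^{\mathrm{ad}_A}-\varphi(\mathrm{ad}_A))V$ (`rotate_sub_staticPart`).
Neither series has a constant term, so the remainder is small with $A$, of order $TV$. Its mean
corrects $D$ and its fluctuation is the new drive. Since $V$ has mean zero, $A$ is periodic and
vanishes at multiples of $T$.

The estimates do not depend on the volume because only overlapping sets contribute to a commutator;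
the price is a loss of decay rate. If the rate drops from $\kappa'$ to $\kappa$, the series in
$\mathrm{ad}_A$ is geometric with ratio $4e^{-\kappa}\|A\|_{\kappa'}/(\kappa'-\kappa)$
(`potNorm_adSeries_le`). With logarithmically decreasing rates the $j$-th step costs a factor of
order `stepLoss j` $/\kappa_0^2$ (`stepRate_step`), and $n_*$ is such that `stepLoss j`
$\le\nu/\nu_0$ up to $j=n_*$ (`stepLoss_le`). Then each step divides the bound on the drive by four
and does not increase the bound on $\|D\|+2\|V\|$ (`IterBound.succ`). The increments form a
convergent series of size $36\,\nu_0/\nu$ (`sum_stepIncr_le`), which controls $\widehat D-D$ and,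
with `potNorm_iterConj_le`, also $YZY^*-Z$.

Potentials are related to operators by `toOp_ad`. As $H$ is only measurable in time, the evolution
equation is carried to the new frame by differentiating Lipschitz functions almost everywhere
(`exp_mul_eq_integral`). -/

namespace DrivenSpin

/-! ### Operators acting within a set of sites -/

section Locality

variable {d q : ℕ} {Λ : Finset (Fin d → ℤ)}

lemma replaceOn_apply_mem {S : Finset Λ} (η : Config q Λ) (ξ : S → Fin q) {x : Λ} (h : x ∈ S) :
    replaceOn S η ξ x = ξ ⟨x, h⟩ := dif_pos h

lemma replaceOn_apply_notMem {S : Finset Λ} (η : Config q Λ) (ξ : S → Fin q) {x : Λ}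
    (h : x ∉ S) : replaceOn S η ξ x = η x := dif_neg h

lemma replaceOn_replaceOn (S : Finset Λ) (η : Config q Λ) (ξ ξ' : S → Fin q) :
    replaceOn S (replaceOn S η ξ) ξ' = replaceOn S η ξ' := by
  funext x
  by_cases h : x ∈ S <;> simp [replaceOn, h]

lemma replaceOn_comm {S₁ S₂ : Finset Λ} (h : Disjoint S₁ S₂) (η : Config q Λ)
    (ξ₁ : S₁ → Fin q) (ξ₂ : S₂ → Fin q) :
    replaceOn S₂ (replaceOn S₁ η ξ₁) ξ₂ = replaceOn S₁ (replaceOn S₂ η ξ₂) ξ₁ := by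
  funext x
  by_cases h₁ : x ∈ S₁
  · have h₂ : x ∉ S₂ := Finset.disjoint_left.1 h h₁
    simp [replaceOn, h₁, h₂]
  · by_cases h₂ : x ∈ S₂ <;> simp [replaceOn, h₁, h₂]

/-- The operators acting within `S`, as a linear subspace. -/
def localOps (q : ℕ) (S : Finset Λ) : Submodule ℂ (Op q Λ) where
  carrier := {O | ActsWithin S O}
  zero_mem' := ⟨0, by simp⟩
  add_mem' := by
    rintro a b ⟨M, hM⟩ ⟨N, hN⟩
    refine ⟨M + N, fun ψ η => ?_⟩
    simp [hM ψ η, hN ψ η, add_mul, Finset.sum_add_distrib]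
  smul_mem' := by
    rintro c a ⟨M, hM⟩
    refine ⟨c • M, fun ψ η => ?_⟩
    simp [hM ψ η, Finset.mul_sum, mul_assoc]

lemma mem_localOps {S : Finset Λ} {O : Op q Λ} : O ∈ localOps q S ↔ ActsWithin S O := Iff.rfl

lemma isClosed_localOps (S : Finset Λ) : IsClosed (localOps q S : Set (Op q Λ)) :=
  Submodule.closed_of_finiteDimensional _

lemma ActsWithin.mul {S : Finset Λ} {O₁ O₂ : Op q Λ} (h₁ : ActsWithin S O₁)
    (h₂ : ActsWithin S O₂) : ActsWithin S (O₁ * O₂) := by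
  obtain ⟨M, hM⟩ := h₁
  obtain ⟨N, hN⟩ := h₂
  refine ⟨fun a b => ∑ c, M a c * N c b, fun ψ η => ?_⟩
  change (O₁ (O₂ ψ)) η = _
  rw [hM]
  have key : ∀ ξ : S → Fin q, (fun x : S => replaceOn S η ξ x) = ξ := fun ξ => by
    funext x; exact replaceOn_apply_mem η ξ x.2
  simp_rw [hN, key, replaceOn_replaceOn, Finset.mul_sum, Finset.sum_mul]
  rw [Finset.sum_comm]
  simp [mul_assoc]

lemma ActsWithin.mono {S S' : Finset Λ} (hS : S ⊆ S') {O : Op q Λ} (h : ActsWithin S O) :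
    ActsWithin S' O := by
  classical
  obtain ⟨M, hM⟩ := h
  -- The matrix on $S'$ is $M\otimes1$: its entries vanish unless both configurations agree off $S$.
  refine ⟨fun a b => if ∀ x : S', x.1 ∉ S → a x = b x then
    M (fun x => a ⟨x, hS x.2⟩) (fun x => b ⟨x, hS x.2⟩) else 0, fun ψ η => ?_⟩
  rw [hM]
  refine Finset.sum_of_injOn (fun ξ (x : S') => replaceOn S η ξ x) ?_ (by simp) ?_ ?_
  · intro ξ _ ξ' _ hh
    funext x
    have := congrFun hh ⟨x, hS x.2⟩
    simpa [replaceOn_apply_mem] using this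
  · intro b _ hb
    beta_reduce
    rw [if_neg, zero_mul]
    intro hx
    apply hb
    refine ⟨fun x => b ⟨x, hS x.2⟩, by simp, ?_⟩
    funext x
    by_cases hxS : x.1 ∈ S
    · simp [replaceOn_apply_mem _ _ hxS]
    · simp [replaceOn_apply_notMem _ _ hxS, hx x hxS]
  · intro ξ _
    beta_reduce
    rw [if_pos]
    · congr 1
      · refine congrArg (M _) (funext fun x => ?_)
        simp [replaceOn_apply_mem]
      · refine congrArg ψ.ofLp (funext fun x => ?_)
        by_cases hx' : x ∈ S'
        · rw [replaceOn_apply_mem _ _ hx']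
        · rw [replaceOn_apply_notMem _ _ hx', replaceOn_apply_notMem _ _ fun hx => hx' (hS hx)]
    · intro x hx
      rw [replaceOn_apply_notMem _ _ hx]

/-- Replacements on disjoint sets commute, and neither affects the row index that the other matrix
reads. -/
lemma ActsWithin.mul_comm {S₁ S₂ : Finset Λ} (hd : Disjoint S₁ S₂) {O₁ O₂ : Op q Λ}
    (h₁ : ActsWithin S₁ O₁) (h₂ : ActsWithin S₂ O₂) : O₁ * O₂ = O₂ * O₁ := by
  obtain ⟨M, hM⟩ := h₁
  obtain ⟨N, hN⟩ := h₂
  ext ψ η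
  have key₁ : ∀ ξ : S₁ → Fin q, (fun x : S₂ => replaceOn S₁ η ξ x) = fun x : S₂ => η x :=
    fun ξ => by
      funext x; exact replaceOn_apply_notMem η ξ (Finset.disjoint_right.1 hd x.2)
  have key₂ : ∀ ξ : S₂ → Fin q, (fun x : S₁ => replaceOn S₂ η ξ x) = fun x : S₁ => η x :=
    fun ξ => by
      funext x; exact replaceOn_apply_notMem η ξ (Finset.disjoint_left.1 hd x.2)
  change (O₁ (O₂ ψ)) η = (O₂ (O₁ ψ)) η
  rw [hM, hN]
  simp_rw [hM, hN, key₁, key₂, Finset.mul_sum]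
  rw [Finset.sum_comm]
  refine Finset.sum_congr rfl fun ξ₂ _ => Finset.sum_congr rfl fun ξ₁ _ => ?_
  rw [replaceOn_comm hd]
  ring

/-- The integral of a family of vectors in a closed subspace of a finite-dimensional space. -/
lemma intervalIntegral_mem_submodule {E : Type*} [NormedAddCommGroup E] [NormedSpace ℂ E]
    [FiniteDimensional ℂ E] (W : Submodule ℂ E) {f : ℝ → E} (hf : ∀ t, f t ∈ W) (a b : ℝ)
    (hi : IntervalIntegrable f volume a b) : ∫ t in a..b, f t ∈ W := by
  -- $W$ is the kernel of the projection onto a complement, and this continuous linear map commutes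
  -- with the integral.
  obtain ⟨W', hW'⟩ := W.exists_isCompl
  let P : E →ₗ[ℂ] E := W'.projection W hW'.symm
  have hker : ∀ x, P x = 0 ↔ x ∈ W := fun x =>
    Submodule.projection_apply_eq_zero_iff hW'.symm
  let L : E →L[ℂ] E := LinearMap.toContinuousLinearMap P
  have : CompleteSpace E := FiniteDimensional.complete ℂ E
  have := L.intervalIntegral_comp_comm hi
  rw [← hker]
  change L _ = 0
  rw [← this]
  simp only [L, LinearMap.coe_toContinuousLinearMap', (hker _).2 (hf _)]
  simp

/-- Two intersecting connected sets have a connected union. -/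
lemma exists_connSet_union [DecidableEq Λ] (S₁ S₂ : ConnSet Λ) (h : ¬ Disjoint S₁.1 S₂.1) :
    ∃ S : ConnSet Λ, S.1 = S₁.1 ∪ S₂.1 := by
  refine ⟨⟨S₁.1 ∪ S₂.1, ?_⟩, rfl⟩
  rw [Finset.coe_union]
  refine SimpleGraph.induce_union_connected S₁.2.preconnected S₂.2.preconnected ?_
  obtain ⟨x, h₁, h₂⟩ := Finset.not_disjoint_iff.1 h
  exact ⟨x, h₁, h₂⟩

end Locality

/-- Coefficient sequences dominated by those of the exponential series. -/
def ExpDominated (c : ℕ → ℝ) : Prop := ∀ m, |c m| ≤ (m.factorial : ℝ)⁻¹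

lemma expDominated_exp : ExpDominated fun m => (m.factorial : ℝ)⁻¹ := fun m => by
  rw [abs_of_nonneg (by positivity)]

/-- The commutator in a ring. -/
def comm {𝔸 : Type*} [Ring 𝔸] (a b : 𝔸) : 𝔸 := a * b - b * a

/-! ### Power series in the commutator of families -/

section Bracket

variable {ι 𝔸 : Type*} [Fintype ι] [NormedRing 𝔸]
  (r : ι → ι → ι → Prop)

open scoped Classical in
/-- The commutator of two families in an algebra, where the terms `[Q_i, Z_j]` with `r i j k` are
collected in the `k`-th component. -/
noncomputable def bracketOn (Q Z : ι → 𝔸) : ι → 𝔸 := fun k =>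
  ∑ i, ∑ j, if r i j k then comm (Q i) (Z j) else 0

lemma continuous_bracketOn :
    Continuous fun p : (ι → 𝔸) × (ι → 𝔸) => bracketOn r p.1 p.2 := by
  refine continuous_pi fun k => ?_
  unfold bracketOn comm
  refine continuous_finsetSum _ fun i _ => continuous_finsetSum _ fun j _ => ?_
  split_ifs <;> fun_prop

lemma continuous_bracketOn_iterate (m : ℕ) :
    Continuous fun p : (ι → 𝔸) × (ι → 𝔸) => (bracketOn r p.1)^[m] p.2 := by
  induction m with
  | zero => exact continuous_snd
  | succ m ih =>
    simp_rw [Function.iterate_succ_apply']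
    exact (continuous_bracketOn r).comp (continuous_fst.prodMk ih)

variable [NormedAlgebra ℂ 𝔸]

/-- `bracketOn r Q` as a continuous linear map. -/
noncomputable def bracketOnCLM (Q : ι → 𝔸) : (ι → 𝔸) →L[ℂ] (ι → 𝔸) where
  toFun := bracketOn r Q
  map_add' Z Z' := by
    funext k
    simp only [bracketOn, Pi.add_apply, ← Finset.sum_add_distrib]
    refine Finset.sum_congr rfl fun i _ => Finset.sum_congr rfl fun j _ => ?_
    split_ifs
    · simp only [comm, mul_add, add_mul]; abel
    · rw [add_zero]
  map_smul' c Z := by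
    funext k
    simp only [bracketOn, Pi.smul_apply, Finset.smul_sum, RingHom.id_apply]
    refine Finset.sum_congr rfl fun i _ => Finset.sum_congr rfl fun j _ => ?_
    split_ifs
    · simp only [comm, mul_smul_comm, smul_mul_assoc, smul_sub]
    · rw [smul_zero]
  cont := (continuous_bracketOn r).comp (Continuous.prodMk_right Q)

lemma norm_bracketOn_iterate_le (Q Z : ι → 𝔸) (m : ℕ) :
    ‖(bracketOn r Q)^[m] Z‖ ≤ ‖bracketOnCLM r Q‖ ^ m * ‖Z‖ := by
  induction m with
  | zero => simp
  | succ m ih =>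
    rw [Function.iterate_succ_apply', pow_succ', mul_assoc]
    exact ((bracketOnCLM r Q).le_opNorm _).trans (by gcongr)

/-- The power series `∑ₘ cₘ ad_Q^m Z` for the bracket `bracketOn r`. -/
noncomputable def bracketSeries (c : ℕ → ℝ) (Q Z : ι → 𝔸) : ι → 𝔸 :=
  ∑' m : ℕ, (c m : ℂ) • (bracketOn r Q)^[m] Z

variable [CompleteSpace 𝔸]

lemma hasSum_bracketSeries {c : ℕ → ℝ} (hc : ExpDominated c) (Q Z : ι → 𝔸) :
    HasSum (fun m : ℕ => (c m : ℂ) • (bracketOn r Q)^[m] Z) (bracketSeries r c Q Z) := by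
  have hs : Summable fun m : ℕ => ‖bracketOnCLM r Q‖ ^ m / m.factorial * ‖Z‖ :=
    (Real.summable_pow_div_factorial _).mul_right _
  refine (Summable.of_norm_bounded hs fun m => ?_).hasSum
  rw [norm_smul, Complex.norm_real, Real.norm_eq_abs, div_eq_inv_mul, mul_assoc]
  exact mul_le_mul (hc m) (norm_bracketOn_iterate_le r Q Z m) (norm_nonneg _) (by positivity)

lemma hasSum_bracketSeries_apply {c : ℕ → ℝ} (hc : ExpDominated c) (Q Z : ι → 𝔸) (k : ι) :
    HasSum (fun m : ℕ => (c m : ℂ) • ((bracketOn r Q)^[m] Z) k) (bracketSeries r c Q Z k) :=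
  Pi.hasSum.1 (hasSum_bracketSeries r hc Q Z) k

lemma hasSum_sum_bracketSeries {c : ℕ → ℝ} (hc : ExpDominated c) (Q Z : ι → 𝔸) :
    HasSum (fun m : ℕ => (c m : ℂ) • ∑ k, ((bracketOn r Q)^[m] Z) k)
      (∑ k, bracketSeries r c Q Z k) := by
  simp_rw [Finset.smul_sum]
  exact hasSum_sum fun k _ => hasSum_bracketSeries_apply r hc Q Z k

lemma aestronglyMeasurable_bracketSeries {c : ℕ → ℝ} (hc : ExpDominated c)
    {Q Z : ℝ → ι → 𝔸} (hQ : AEStronglyMeasurable Q volume)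
    (hZ : AEStronglyMeasurable Z volume) :
    AEStronglyMeasurable (fun t => bracketSeries r c (Q t) (Z t)) volume := by
  refine aestronglyMeasurable_of_tendsto_ae Filter.atTop
    (f := fun n t => ∑ m ∈ Finset.range n, (c m : ℂ) • (bracketOn r (Q t))^[m] (Z t)) (fun n => ?_)
    (Filter.Eventually.of_forall fun t =>
      (hasSum_bracketSeries r hc (Q t) (Z t)).tendsto_sum_nat)
  refine Finset.aestronglyMeasurable_fun_sum _ fun m _ => ?_
  have h := (continuous_bracketOn_iterate (𝔸 := 𝔸) r m).comp_aestronglyMeasurable (hQ.prodMk hZ)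
  exact (continuous_const_smul (c m : ℂ)).comp_aestronglyMeasurable h

/-- The commutator of a skew-adjoint and a self-adjoint element is self-adjoint, and the
coefficients are real. -/
lemma isSelfAdjoint_bracketSeries {c : ℕ → ℝ} (hc : ExpDominated c) [StarRing 𝔸]
    [StarModule ℂ 𝔸] [ContinuousStar 𝔸] {Q Z : ι → 𝔸}
    (hQ : ∀ k, Q k ∈ skewAdjoint 𝔸) (hZ : ∀ k, IsSelfAdjoint (Z k)) (k : ι) :
    IsSelfAdjoint (bracketSeries r c Q Z k) := by
  have hm : ∀ m k, IsSelfAdjoint ((bracketOn r Q)^[m] Z k) := fun m => by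
    induction m with
    | zero => exact hZ
    | succ m ih =>
      intro k
      rw [Function.iterate_succ_apply']
      refine isSelfAdjoint_sum _ fun i _ => isSelfAdjoint_sum _ fun j _ => ?_
      split_ifs
      · rw [comm, isSelfAdjoint_iff, star_sub, star_mul, star_mul, skewAdjoint.mem_iff.1 (hQ i),
          (ih j).star_eq]
        simp only [mul_neg, neg_mul]
        abel
      · exact IsSelfAdjoint.zero _
  have h := hasSum_bracketSeries_apply r hc Q Z k
  refine HasSum.unique ?_ h
  simpa only [star_smul, (hm _ k).star_eq, Complex.star_def, Complex.conj_ofReal] using h.star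

end Bracket

/-! ### From commutators of potentials to commutators of operators -/

section AdAlgebra

variable {d q : ℕ} {Λ : Finset (Fin d → ℤ)}

/-- `S₁ ∪ S₂ = S`, for connected sets. -/
def UnionEq (S₁ S₂ S : ConnSet Λ) : Prop :=
  letI := Classical.decEq Λ
  S₁.1 ∪ S₂.1 = S.1

lemma ad_eq_bracketOn (Q : Potential q Λ) : ad Q = bracketOn UnionEq Q := by
  funext Z S
  unfold ad bracketOn comm UnionEq
  congr!

/-- The power series `∑ₘ cₘ ad_Q^m Z`. -/
noncomputable def adSeries (c : ℕ → ℝ) (Q Z : Potential q Λ) : Potential q Λ :=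
  bracketSeries UnionEq c Q Z

lemma hasSum_adSeries_apply {c : ℕ → ℝ} (hc : ExpDominated c) (Q Z : Potential q Λ)
    (S : ConnSet Λ) : HasSum (fun m : ℕ => (c m : ℂ) • ((ad Q)^[m] Z) S) (adSeries c Q Z S) := by
  rw [ad_eq_bracketOn]
  exact hasSum_bracketSeries_apply UnionEq hc Q Z S

lemma expAd_eq_adSeries (Q Z : Potential q Λ) :
    expAd Q Z = adSeries (fun m => (m.factorial : ℝ)⁻¹) Q Z := by
  funext S
  rw [← (hasSum_adSeries_apply expDominated_exp Q Z S).tsum_eq]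
  refine tsum_congr fun m => ?_
  push_cast
  rfl

lemma IsLocal.ad {Q Z : Potential q Λ} (hQ : IsLocal Q) (hZ : IsLocal Z) :
    IsLocal (ad Q Z) := by
  intro S
  rw [← mem_localOps]
  unfold DrivenSpin.ad
  refine sum_mem fun S₁ _ => sum_mem fun S₂ _ => ?_
  split_ifs with h
  · have h₁ := (hQ S₁).mono (S' := S.1) (by rw [← h]; exact Finset.subset_union_left)
    have h₂ := (hZ S₂).mono (S' := S.1) (by rw [← h]; exact Finset.subset_union_right)
    exact sub_mem (mem_localOps.2 (h₁.mul h₂)) (mem_localOps.2 (h₂.mul h₁))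
  · exact zero_mem _

lemma IsLocal.ad_iterate {Q Z : Potential q Λ} (hQ : IsLocal Q) (hZ : IsLocal Z) (m : ℕ) :
    IsLocal ((DrivenSpin.ad Q)^[m] Z) := by
  induction m with
  | zero => exact hZ
  | succ m ih => rw [Function.iterate_succ_apply']; exact hQ.ad ih

lemma IsLocal.adSeries {c : ℕ → ℝ} (hc : ExpDominated c) {Q Z : Potential q Λ} (hQ : IsLocal Q)
    (hZ : IsLocal Z) : IsLocal (adSeries c Q Z) := by
  intro S
  refine (isClosed_localOps S.1).mem_of_tendsto (hasSum_adSeries_apply hc Q Z S)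
    (Filter.Eventually.of_forall fun s => sum_mem fun m _ => ?_)
  exact (localOps q S.1).smul_mem _ (hQ.ad_iterate hZ m S)

lemma IsLocal.sub {Z Z' : Potential q Λ} (hZ : IsLocal Z) (hZ' : IsLocal Z') :
    IsLocal (Z - Z') := fun S => sub_mem (mem_localOps.2 (hZ S)) (mem_localOps.2 (hZ' S))

lemma comm_eq_zero_of_disjoint {Q Z : Potential q Λ} (hQ : IsLocal Q) (hZ : IsLocal Z)
    {S₁ S₂ : ConnSet Λ} (h : Disjoint S₁.1 S₂.1) : comm (Q S₁) (Z S₂) = 0 :=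
  sub_eq_zero.2 (ActsWithin.mul_comm h (hQ S₁) (hZ S₂))

/-- Indexing by connected sets loses nothing: disjoint supports commute, and the union of two
intersecting connected sets is connected, so each such pair is counted in exactly one component. -/
lemma toOp_ad {Q Z : Potential q Λ} (hQ : IsLocal Q) (hZ : IsLocal Z) :
    toOp (ad Q Z) = comm (toOp Q) (toOp Z) := by
  classical
  have hcomm : comm (toOp Q) (toOp Z) = ∑ S₁, ∑ S₂, comm (Q S₁) (Z S₂) := by
    unfold comm toOp
    rw [Finset.sum_mul_sum, Finset.sum_mul_sum,
      Finset.sum_comm (s := Finset.univ (α := ConnSet Λ)) (f := fun i j => Z i * Q j)]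
    simp only [Finset.sum_sub_distrib]
  rw [hcomm]
  unfold toOp ad
  rw [Finset.sum_comm]
  refine Finset.sum_congr rfl fun S₁ _ => ?_
  rw [Finset.sum_comm]
  refine Finset.sum_congr rfl fun S₂ _ => ?_
  by_cases h : Disjoint S₁.1 S₂.1
  · have h0 := comm_eq_zero_of_disjoint hQ hZ h
    rw [h0]
    unfold comm at h0
    simp only [h0, ite_self, Finset.sum_const_zero]
  · obtain ⟨S, hS⟩ := exists_connSet_union S₁ S₂ h
    rw [Finset.sum_eq_single S]
    · rw [if_pos hS.symm]; rfl
    · intro S' _ hne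
      rw [if_neg]
      intro hh
      apply hne
      apply Subtype.ext
      rw [← hh, hS]
    · simp

lemma toOp_ad_iterate {Q Z : Potential q Λ} (hQ : IsLocal Q) (hZ : IsLocal Z) (m : ℕ) :
    toOp ((ad Q)^[m] Z) = (comm (toOp Q))^[m] (toOp Z) := by
  induction m with
  | zero => rfl
  | succ m ih =>
    rw [Function.iterate_succ_apply', toOp_ad hQ (hQ.ad_iterate hZ m),
      Function.iterate_succ_apply', ← ih]

lemma hasSum_toOp_adSeries {c : ℕ → ℝ} (hc : ExpDominated c) {Q Z : Potential q Λ}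
    (hQ : IsLocal Q) (hZ : IsLocal Z) :
    HasSum (fun m : ℕ => (c m : ℂ) • (comm (toOp Q))^[m] (toOp Z)) (toOp (adSeries c Q Z)) := by
  simp_rw [← toOp_ad_iterate hQ hZ, ad_eq_bracketOn]
  exact hasSum_sum_bracketSeries UnionEq hc Q Z

end AdAlgebra

/-! ### Weighted norms and overlapping sets -/

section Weighted

variable {d q : ℕ} {Λ : Finset (Fin d → ℤ)}

/-- The weight `e^{κ|S|}`. -/
noncomputable def weight (κ : ℝ) (S : ConnSet Λ) : ℝ≥0∞ :=
  ENNReal.ofReal (Real.exp (κ * S.1.card))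

open scoped Classical in
/-- The norm `sup_x ∑_{S ∋ x} e^{κ|S|} a_S` of a family of extended nonnegative numbers. -/
noncomputable def weightedSup (κ : ℝ) (a : ConnSet Λ → ℝ≥0∞) : ℝ≥0∞ :=
  ⨆ x : Λ, ∑ S : ConnSet Λ with x ∈ S.1, weight κ S * a S

/-- The supremum over time of the norms of the components. -/
noncomputable def supEnorm (Z : ℝ → Potential q Λ) (S : ConnSet Λ) : ℝ≥0∞ := ⨆ t, ‖Z t S‖ₑ

lemma potNorm_eq_weightedSup (κ : ℝ) (Z : ℝ → Potential q Λ) :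
    potNorm κ Z = weightedSup κ (supEnorm Z) := rfl

lemma enorm_le_supEnorm (Z : ℝ → Potential q Λ) (t : ℝ) (S : ConnSet Λ) :
    ‖Z t S‖ₑ ≤ supEnorm Z S := le_iSup (fun t => ‖Z t S‖ₑ) t

open scoped Classical in
/-- The majorant of the commutator of two potentials. -/
noncomputable def overlapConv (a z : ConnSet Λ → ℝ≥0∞) (S : ConnSet Λ) : ℝ≥0∞ :=
  ∑ S₁ : ConnSet Λ, ∑ S₂ : ConnSet Λ,
    if UnionEq S₁ S₂ S ∧ ¬ Disjoint S₁.1 S₂.1 then a S₁ * z S₂ else 0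

lemma weight_mono {κ κ' : ℝ} (h : κ ≤ κ') (S : ConnSet Λ) : weight κ S ≤ weight κ' S := by
  unfold weight
  gcongr

lemma weightedSup_mono {κ κ' : ℝ} (h : κ ≤ κ') {a b : ConnSet Λ → ℝ≥0∞} (hab : ∀ S, a S ≤ b S) :
    weightedSup κ a ≤ weightedSup κ' b :=
  iSup_mono fun _ => Finset.sum_le_sum fun S _ => mul_le_mul' (weight_mono h S) (hab S)

lemma sum_le_weightedSup (κ : ℝ) (a : ConnSet Λ → ℝ≥0∞) (x : Λ) :
    (open scoped Classical in ∑ S : ConnSet Λ with x ∈ S.1, weight κ S * a S) ≤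
      weightedSup κ a :=
  le_iSup (fun x : Λ => open scoped Classical in
    ∑ S : ConnSet Λ with x ∈ S.1, weight κ S * a S) x

/-- From $te^{-t}\le e^{-1}$ at $t=\varepsilon|S|$: a factor $|S|$ is paid for by raising the rate
by $\varepsilon$. -/
lemma weight_mul_card_le (κ : ℝ) {ε : ℝ} (hε : 0 < ε) (S : ConnSet Λ) :
    weight κ S * (S.1.card : ℝ≥0∞) ≤
      ENNReal.ofReal (Real.exp (-1) / ε) * weight (κ + ε) S := by
  unfold weight
  rw [← ENNReal.ofReal_natCast, ← ENNReal.ofReal_mul (by positivity),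
    ← ENNReal.ofReal_mul (by positivity)]
  refine ENNReal.ofReal_le_ofReal ?_
  have h := Real.mul_exp_neg_le_exp_neg_one (ε * S.1.card)
  rw [add_mul, Real.exp_add, div_mul_eq_mul_div, le_div_iff₀ hε]
  have h2 : (S.1.card : ℝ) * ε ≤ Real.exp (-1) * Real.exp (ε * S.1.card) := by
    have h3 := mul_le_mul_of_nonneg_right h (Real.exp_pos (ε * S.1.card)).le
    rw [mul_assoc, ← Real.exp_add, neg_add_cancel, Real.exp_zero, mul_one] at h3
    linarith
  calc Real.exp (κ * S.1.card) * S.1.card * ε = Real.exp (κ * S.1.card) * (S.1.card * ε) := by ring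
    _ ≤ Real.exp (κ * S.1.card) * (Real.exp (-1) * Real.exp (ε * S.1.card)) := by gcongr
    _ = _ := by ring

-- A set meeting $S_1$ contains one of its $|S_1|$ sites, and the norm bounds the sum over sets
-- through any one site.
open scoped Classical in
lemma sum_overlap_le (κ : ℝ) (z : ConnSet Λ → ℝ≥0∞) (S₁ : ConnSet Λ) :
    ∑ S₂ : ConnSet Λ, (if ¬ Disjoint S₁.1 S₂.1 then weight κ S₂ * z S₂ else 0) ≤
      S₁.1.card * weightedSup κ z := by
  calc ∑ S₂ : ConnSet Λ, (if ¬ Disjoint S₁.1 S₂.1 then weight κ S₂ * z S₂ else 0)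
      ≤ ∑ S₂ : ConnSet Λ, ∑ y ∈ S₁.1, (if y ∈ S₂.1 then weight κ S₂ * z S₂ else 0) := by
        refine Finset.sum_le_sum fun S₂ _ => ?_
        split_ifs with h
        · exact zero_le
        · obtain ⟨y, h₁, h₂⟩ := Finset.not_disjoint_iff.1 h
          refine le_trans ?_ (Finset.single_le_sum (fun _ _ => zero_le) h₁)
          rw [if_pos h₂]
    _ = ∑ y ∈ S₁.1, ∑ S₂ : ConnSet Λ with y ∈ S₂.1, weight κ S₂ * z S₂ := by
        rw [Finset.sum_comm]
        simp_rw [Finset.sum_filter]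
    _ ≤ ∑ y ∈ S₁.1, weightedSup κ z := Finset.sum_le_sum fun y _ => sum_le_weightedSup κ z y
    _ = _ := by rw [Finset.sum_const, nsmul_eq_mul]

-- For fixed $S_1\ni x$ the sum over $S_2$ costs a factor $|S_1|$, which the higher rate on $S_1$
-- absorbs.
open scoped Classical in
lemma sum_sum_overlap_le (κ : ℝ) {ε : ℝ} (hε : 0 < ε) (a z : ConnSet Λ → ℝ≥0∞) (x : Λ) :
    ∑ S₁ : ConnSet Λ, ∑ S₂ : ConnSet Λ, (if ¬ Disjoint S₁.1 S₂.1 then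
      if x ∈ S₁.1 then (weight κ S₁ * a S₁) * (weight κ S₂ * z S₂) else 0 else 0) ≤
      ENNReal.ofReal (Real.exp (-1) / ε) * (weightedSup (κ + ε) a * weightedSup (κ + ε) z) := by
  calc ∑ S₁ : ConnSet Λ, ∑ S₂ : ConnSet Λ, (if ¬ Disjoint S₁.1 S₂.1 then
      if x ∈ S₁.1 then (weight κ S₁ * a S₁) * (weight κ S₂ * z S₂) else 0 else 0)
      = ∑ S₁ : ConnSet Λ with x ∈ S₁.1, (weight κ S₁ * a S₁) *
          ∑ S₂ : ConnSet Λ, (if ¬ Disjoint S₁.1 S₂.1 then weight κ S₂ * z S₂ else 0) := by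
        rw [Finset.sum_filter]
        refine Finset.sum_congr rfl fun S₁ _ => ?_
        split_ifs with h
        · simp_rw [Finset.mul_sum, mul_ite, mul_zero]
        · simp
    _ ≤ ∑ S₁ : ConnSet Λ with x ∈ S₁.1, (weight κ S₁ * a S₁) *
          (S₁.1.card * weightedSup (κ + ε) z) := by
        gcongr with S₁ _
        exact (sum_overlap_le κ z S₁).trans
          (mul_le_mul_right (weightedSup_mono (by linarith) fun _ => le_rfl) _)
    _ ≤ ∑ S₁ : ConnSet Λ with x ∈ S₁.1, (ENNReal.ofReal (Real.exp (-1) / ε) *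
          weightedSup (κ + ε) z) * (weight (κ + ε) S₁ * a S₁) := by
        refine Finset.sum_le_sum fun S₁ _ => ?_
        calc (weight κ S₁ * a S₁) * (S₁.1.card * weightedSup (κ + ε) z)
            = (weight κ S₁ * S₁.1.card) * (a S₁ * weightedSup (κ + ε) z) := by ring
          _ ≤ (ENNReal.ofReal (Real.exp (-1) / ε) * weight (κ + ε) S₁) *
              (a S₁ * weightedSup (κ + ε) z) := mul_le_mul_left (weight_mul_card_le κ hε S₁) _
          _ = _ := by ring
    _ ≤ (ENNReal.ofReal (Real.exp (-1) / ε) * weightedSup (κ + ε) z) *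
          weightedSup (κ + ε) a := by
        rw [← Finset.mul_sum]
        exact mul_le_mul_right (sum_le_weightedSup _ _ _) _
    _ = _ := by ring

-- Overlapping sets share a site, so $|S|+1\le|S_1|+|S_2|$. The gain $e^{-\kappa}$ matters for large
-- rates: `stepRate_step` uses that $\kappa e^{-\kappa}$ is bounded.
open scoped Classical in
lemma weight_union_le {κ : ℝ} (hκ : 0 ≤ κ) {S₁ S₂ S : ConnSet Λ} (h : S.1 = S₁.1 ∪ S₂.1)
    (hd : ¬ Disjoint S₁.1 S₂.1) :
    weight κ S ≤ ENNReal.ofReal (Real.exp (-κ)) * (weight κ S₁ * weight κ S₂) := by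
  unfold weight
  rw [← ENNReal.ofReal_mul (by positivity), ← ENNReal.ofReal_mul (by positivity),
    ← Real.exp_add, ← Real.exp_add]
  refine ENNReal.ofReal_le_ofReal (Real.exp_le_exp.2 ?_)
  have h1 : S.1.card + 1 ≤ S₁.1.card + S₂.1.card := by
    rw [h, ← Finset.card_union_add_card_inter]
    have : 0 < (S₁.1 ∩ S₂.1).card := by
      rw [Finset.card_pos, Finset.nonempty_iff_ne_empty]
      exact fun h => hd (Finset.disjoint_iff_inter_eq_empty.2 h)
    omega
  have h2 : (S.1.card : ℝ) + 1 ≤ S₁.1.card + S₂.1.card := by exact_mod_cast h1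
  nlinarith

lemma weightedSup_overlapConv_le {κ ε : ℝ} (hκ : 0 ≤ κ) (hε : 0 < ε) (a z : ConnSet Λ → ℝ≥0∞) :
    weightedSup κ (overlapConv a z) ≤ ENNReal.ofReal (2 * Real.exp (-κ) * Real.exp (-1) / ε) *
      (weightedSup (κ + ε) a * weightedSup (κ + ε) z) := by
  classical
  refine iSup_le fun x => ?_
  let F : ConnSet Λ → ConnSet Λ → ℝ≥0∞ := fun S₁ S₂ =>
    (weight κ S₁ * a S₁) * (weight κ S₂ * z S₂)
  calc ∑ S : ConnSet Λ with x ∈ S.1, weight κ S * overlapConv a z S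
      = ∑ S₁ : ConnSet Λ, ∑ S₂ : ConnSet Λ, ∑ S : ConnSet Λ, if x ∈ S.1 then
          if UnionEq S₁ S₂ S ∧ ¬ Disjoint S₁.1 S₂.1 then weight κ S * (a S₁ * z S₂) else 0
          else 0 := by
        rw [Finset.sum_filter]
        simp_rw [overlapConv, Finset.mul_sum, mul_ite, mul_zero]
        rw [Finset.sum_congr rfl fun S₁ _ => Finset.sum_comm, Finset.sum_comm]
        refine Finset.sum_congr rfl fun S _ => ?_
        split_ifs <;> simp
    -- A site of $S_1\cup S_2$ lies in $S_1$ or in $S_2$. The two cases are symmetric and give the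
    -- factor $2$.
    _ ≤ ∑ S₁ : ConnSet Λ, ∑ S₂ : ConnSet Λ, ENNReal.ofReal (Real.exp (-κ)) *
          ((if ¬ Disjoint S₁.1 S₂.1 then if x ∈ S₁.1 then F S₁ S₂ else 0 else 0) +
          (if ¬ Disjoint S₁.1 S₂.1 then if x ∈ S₂.1 then F S₁ S₂ else 0 else 0)) := by
        refine Finset.sum_le_sum fun S₁ _ => Finset.sum_le_sum fun S₂ _ => ?_
        by_cases hd : Disjoint S₁.1 S₂.1
        · simp [hd]
        obtain ⟨S, hS⟩ := exists_connSet_union S₁ S₂ hd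
        rw [Finset.sum_eq_single S]
        · simp only [hd, not_false_eq_true, and_true, if_true]
          by_cases hx : x ∈ S.1
          · rw [if_pos hx]
            have hF : (if UnionEq S₁ S₂ S then weight κ S * (a S₁ * z S₂) else 0) ≤
                ENNReal.ofReal (Real.exp (-κ)) * F S₁ S₂ := by
              split_ifs
              · calc weight κ S * (a S₁ * z S₂)
                    ≤ (ENNReal.ofReal (Real.exp (-κ)) * (weight κ S₁ * weight κ S₂)) *
                      (a S₁ * z S₂) := mul_le_mul_left (weight_union_le hκ hS hd) _
                  _ = _ := by simp only [F]; ring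
              · exact zero_le
            refine hF.trans (mul_le_mul_right ?_ _)
            rw [hS, Finset.mem_union] at hx
            rcases hx with hx | hx
            · rw [if_pos hx]; exact le_self_add
            · rw [if_pos hx]; exact le_add_self
          · rw [if_neg hx]; exact zero_le
        · intro S' _ hne
          split_ifs with h1 h2
          · exfalso
            apply hne
            apply Subtype.ext
            rw [hS, ← h2.1]
            congr!
          · rfl
          · rfl
        · simp
    _ = ENNReal.ofReal (Real.exp (-κ)) *
          ((∑ S₁ : ConnSet Λ, ∑ S₂ : ConnSet Λ,
            if ¬ Disjoint S₁.1 S₂.1 then if x ∈ S₁.1 then F S₁ S₂ else 0 else 0) +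
          ∑ S₁ : ConnSet Λ, ∑ S₂ : ConnSet Λ,
            if ¬ Disjoint S₁.1 S₂.1 then if x ∈ S₂.1 then F S₁ S₂ else 0 else 0) := by
        simp_rw [← Finset.mul_sum, Finset.sum_add_distrib]
    _ ≤ ENNReal.ofReal (Real.exp (-κ)) *
          (ENNReal.ofReal (Real.exp (-1) / ε) * (weightedSup (κ + ε) a * weightedSup (κ + ε) z) +
          ENNReal.ofReal (Real.exp (-1) / ε) *
            (weightedSup (κ + ε) z * weightedSup (κ + ε) a)) := by
        refine mul_le_mul_right (add_le_add (sum_sum_overlap_le κ hε a z x) ?_) _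
        refine le_trans (le_of_eq ?_) (sum_sum_overlap_le κ hε z a x)
        rw [Finset.sum_comm]
        refine Finset.sum_congr rfl fun S₁ _ => Finset.sum_congr rfl fun S₂ _ => ?_
        simp only [F, disjoint_comm (a := S₁.1), mul_comm (weight κ S₁ * z S₁)]
    _ = _ := by
        rw [mul_comm (weightedSup (κ + ε) z), ← two_mul, mul_left_comm, ← mul_assoc,
          ← mul_assoc, ← ENNReal.ofReal_ofNat, ← ENNReal.ofReal_mul (by positivity),
          ← ENNReal.ofReal_mul (by positivity)]
        congr 2
        ring

lemma weightedSup_const_mul (κ : ℝ) (c : ℝ≥0∞) (a : ConnSet Λ → ℝ≥0∞) :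
    weightedSup κ (fun S => c * a S) = c * weightedSup κ a := by
  unfold weightedSup
  simp_rw [ENNReal.mul_iSup, Finset.mul_sum]
  refine iSup_congr fun x => Finset.sum_congr rfl fun S _ => by ring

lemma weightedSup_add_le (κ : ℝ) (a b : ConnSet Λ → ℝ≥0∞) :
    weightedSup κ (fun S => a S + b S) ≤ weightedSup κ a + weightedSup κ b := by
  refine iSup_le fun x => ?_
  simp_rw [mul_add, Finset.sum_add_distrib]
  exact add_le_add (sum_le_weightedSup κ a x) (sum_le_weightedSup κ b x)

lemma weightedSup_tsum_le (κ : ℝ) (f : ℕ → ConnSet Λ → ℝ≥0∞) :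
    weightedSup κ (fun S => ∑' m, f m S) ≤ ∑' m, weightedSup κ (f m) := by
  refine iSup_le fun x => ?_
  simp_rw [← ENNReal.tsum_mul_left]
  rw [← Summable.tsum_finsetSum fun _ _ => ENNReal.summable]
  exact ENNReal.tsum_le_tsum fun m => sum_le_weightedSup κ (f m) x

end Weighted

lemma enorm_comm_le {𝔸 : Type*} [NormedRing 𝔸] (a b : 𝔸) : ‖comm a b‖ₑ ≤ 2 * (‖a‖ₑ * ‖b‖ₑ) := by
  have h : ‖comm a b‖ ≤ 2 * (‖a‖ * ‖b‖) := by
    refine (norm_sub_le _ _).trans ?_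
    linarith [norm_mul_le a b, norm_mul_le b a]
  rw [← ofReal_norm, ← ofReal_norm, ← ofReal_norm,
    ← ENNReal.ofReal_mul (norm_nonneg _), ← ENNReal.ofReal_ofNat,
    ← ENNReal.ofReal_mul (by positivity)]
  exact ENNReal.ofReal_le_ofReal h

lemma enorm_coe_smul {E : Type*} [NormedAddCommGroup E] [NormedSpace ℂ E] (c : ℝ) (v : E) :
    ‖(c : ℂ) • v‖ₑ = ENNReal.ofReal |c| * ‖v‖ₑ := by
  rw [enorm_smul, ← ofReal_norm (c : ℂ), Complex.norm_real, Real.norm_eq_abs]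

lemma enorm_sub_le_add {E : Type*} [NormedAddCommGroup E] (a b : E) :
    ‖a - b‖ₑ ≤ ‖a‖ₑ + ‖b‖ₑ := by
  rw [sub_eq_add_neg, ← enorm_neg b]
  exact enorm_add_le _ _

lemma enorm_add_le_add {E : Type*} [NormedAddCommGroup E] (a b : E) :
    ‖a + b‖ₑ ≤ ‖a‖ₑ + ‖b‖ₑ := enorm_add_le _ _

lemma enorm_zero_le {E : Type*} [NormedAddCommGroup E] (c : ℝ≥0∞) : ‖(0 : E)‖ₑ ≤ c := by
  simp

lemma enorm_tsum_le {E : Type*} [NormedAddCommGroup E] (f : ℕ → E) :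
    ‖∑' m, f m‖ₑ ≤ ∑' m, ‖f m‖ₑ := enorm_tsum_le_tsum_enorm

/-! ### Norm estimates for series in `ad` -/

section PotNorm

variable {d q : ℕ} {Λ : Finset (Fin d → ℤ)}

lemma potNorm_mono {κ κ' : ℝ} (h : κ ≤ κ') {Z Z' : ℝ → Potential q Λ}
    (hZ : ∀ t S, ‖Z t S‖ₑ ≤ supEnorm Z' S) : potNorm κ Z ≤ potNorm κ' Z' :=
  weightedSup_mono h fun S => iSup_le fun t => hZ t S

lemma potNorm_mono_rate {κ κ' : ℝ} (h : κ ≤ κ') (Z : ℝ → Potential q Λ) :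
    potNorm κ Z ≤ potNorm κ' Z := potNorm_mono h fun t S => enorm_le_supEnorm Z t S

lemma potNorm_add_le (κ : ℝ) (Z Z' : ℝ → Potential q Λ) :
    potNorm κ (fun t => Z t + Z' t) ≤ potNorm κ Z + potNorm κ Z' := by
  refine le_trans (weightedSup_mono le_rfl fun S => iSup_le fun t => ?_)
    (weightedSup_add_le κ (supEnorm Z) (supEnorm Z'))
  exact (enorm_add_le_add _ _).trans
    (add_le_add (enorm_le_supEnorm Z t S) (enorm_le_supEnorm Z' t S))

lemma potNorm_sub_le (κ : ℝ) (Z Z' : ℝ → Potential q Λ) :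
    potNorm κ (fun t => Z t - Z' t) ≤ potNorm κ Z + potNorm κ Z' := by
  refine le_trans (weightedSup_mono le_rfl fun S => iSup_le fun t => ?_)
    (weightedSup_add_le κ (supEnorm Z) (supEnorm Z'))
  exact (enorm_sub_le_add _ _).trans
    (add_le_add (enorm_le_supEnorm Z t S) (enorm_le_supEnorm Z' t S))

lemma potNorm_le_const_mul {κ : ℝ} {c : ℝ≥0∞} {Z Z' : ℝ → Potential q Λ}
    (h : ∀ t S, ‖Z t S‖ₑ ≤ c * supEnorm Z' S) : potNorm κ Z ≤ c * potNorm κ Z' := by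
  rw [potNorm_eq_weightedSup κ Z', ← weightedSup_const_mul]
  exact weightedSup_mono le_rfl fun S => iSup_le fun t => h t S

lemma potNorm_lt_top (κ : ℝ) {Z : ℝ → Potential q Λ} (h : ∃ M : ℝ, ∀ t S, ‖Z t S‖ ≤ M) :
    potNorm κ Z < ∞ := by
  obtain ⟨M, hM⟩ := h
  rw [potNorm_eq_weightedSup]
  unfold weightedSup
  refine lt_of_le_of_lt (iSup_le fun x => Finset.single_le_sum (f := fun x : Λ =>
    open scoped Classical in ∑ S : ConnSet Λ with x ∈ S.1, weight κ S * supEnorm Z S)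
    (fun _ _ => zero_le) (Finset.mem_univ x)) (ENNReal.sum_lt_top.2 fun x _ => ?_)
  refine ENNReal.sum_lt_top.2 fun S _ => ENNReal.mul_lt_top ENNReal.ofReal_lt_top ?_
  refine lt_of_le_of_lt (iSup_le fun t => ?_) (ENNReal.ofReal_lt_top (r := M))
  rw [← ofReal_norm]
  exact ENNReal.ofReal_le_ofReal (hM t S)

lemma supEnorm_ad_le {Q Z : ℝ → Potential q Λ} (hQ : ∀ t, IsLocal (Q t))
    (hZ : ∀ t, IsLocal (Z t)) (S : ConnSet Λ) :
    supEnorm (fun t => ad (Q t) (Z t)) S ≤ 2 * overlapConv (supEnorm Q) (supEnorm Z) S := by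
  classical
  refine iSup_le fun t => ?_
  simp only [ad_eq_bracketOn]
  unfold bracketOn overlapConv
  simp_rw [Finset.mul_sum]
  refine (enorm_sum_le (ε := Op q Λ) _ _).trans (Finset.sum_le_sum fun S₁ _ => ?_)
  refine (enorm_sum_le (ε := Op q Λ) _ _).trans (Finset.sum_le_sum fun S₂ _ => ?_)
  by_cases hd : Disjoint S₁.1 S₂.1
  · rw [comm_eq_zero_of_disjoint (hQ t) (hZ t) hd, ite_self]
    exact enorm_zero_le (E := Op q Λ) _
  · by_cases hu : UnionEq S₁ S₂ S
    · rw [if_pos hu, if_pos ⟨hu, hd⟩]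
      refine (enorm_comm_le _ _).trans ?_
      gcongr <;> exact enorm_le_supEnorm _ t _
    · rw [if_neg hu]
      exact enorm_zero_le (E := Op q Λ) _

/-- The $4$ is $2$ for the two terms of a commutator times $2$ from `weightedSup_overlapConv_le`. -/
lemma potNorm_ad_le {κ ε : ℝ} (hκ : 0 ≤ κ) (hε : 0 < ε) {Q Z : ℝ → Potential q Λ}
    (hQ : ∀ t, IsLocal (Q t)) (hZ : ∀ t, IsLocal (Z t)) :
    potNorm κ (fun t => ad (Q t) (Z t)) ≤
      ENNReal.ofReal (4 * Real.exp (-κ) * Real.exp (-1) / ε) *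
        (potNorm (κ + ε) Q * potNorm (κ + ε) Z) := by
  calc potNorm κ (fun t => ad (Q t) (Z t))
      ≤ weightedSup κ (fun S => 2 * overlapConv (supEnorm Q) (supEnorm Z) S) :=
        weightedSup_mono le_rfl fun S => supEnorm_ad_le hQ hZ S
    _ ≤ 2 * (ENNReal.ofReal (2 * Real.exp (-κ) * Real.exp (-1) / ε) *
        (potNorm (κ + ε) Q * potNorm (κ + ε) Z)) := by
        rw [weightedSup_const_mul]
        exact mul_le_mul_right (weightedSup_overlapConv_le hκ hε _ _) _
    _ = _ := by
        rw [← mul_assoc, ← ENNReal.ofReal_ofNat, ← ENNReal.ofReal_mul (by positivity)]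
        congr 2
        ring

/-- Each commutator costs $\varepsilon$ of the rate. The induction raises $\kappa'$, while the
prefactor keeps the lowest rate $\kappa$. -/
lemma potNorm_ad_iterate_le {κ κ' ε : ℝ} (hκ : 0 ≤ κ) (hκ' : κ ≤ κ') (hε : 0 < ε)
    {Q Z : ℝ → Potential q Λ} (hQ : ∀ t, IsLocal (Q t)) (hZ : ∀ t, IsLocal (Z t)) (m : ℕ) :
    potNorm κ' (fun t => (ad (Q t))^[m] (Z t)) ≤
      (ENNReal.ofReal (4 * Real.exp (-κ) * Real.exp (-1) / ε) * potNorm (κ' + m * ε) Q) ^ m *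
        potNorm (κ' + m * ε) Z := by
  induction m generalizing κ' with
  | zero => simp
  | succ m ih =>
    simp_rw [Function.iterate_succ_apply']
    have h1 := potNorm_ad_le (hκ.trans hκ') hε hQ (fun t => (hQ t).ad_iterate (hZ t) m)
    have h2 := ih (κ' := κ' + ε) (by linarith)
    have h3 : κ' + ε + m * ε = κ' + (m + 1 : ℕ) * ε := by push_cast; ring
    rw [h3] at h2
    have h4 : κ' + ε ≤ κ' + (m + 1 : ℕ) * ε := by
      push_cast
      nlinarith [mul_nonneg (Nat.cast_nonneg (α := ℝ) m) hε.le]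
    refine h1.trans ?_
    rw [pow_succ', mul_assoc (ENNReal.ofReal _ * _), mul_assoc (ENNReal.ofReal _)]
    exact mul_le_mul' (by gcongr) (mul_le_mul' (potNorm_mono_rate h4 Q) h2)

lemma pow_div_factorial_mul_exp_le (m : ℕ) :
    (m.factorial : ℝ)⁻¹ * (Real.exp (-1) * m) ^ m ≤ 1 := by
  have h := Real.pow_div_factorial_le_exp (m : ℝ) (Nat.cast_nonneg m) m
  rw [mul_pow, ← Real.exp_nat_mul, mul_neg_one]
  calc (m.factorial : ℝ)⁻¹ * (Real.exp (-m) * (m : ℝ) ^ m)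
      = (m : ℝ) ^ m / m.factorial * Real.exp (-m) := by ring
    _ ≤ Real.exp m * Real.exp (-m) := by gcongr
    _ = 1 := by rw [← Real.exp_add, add_neg_cancel, Real.exp_zero]

lemma potNorm_coeff_smul_ad_iterate_le {κ κ' : ℝ} (hκ : 0 ≤ κ) (hκ' : κ < κ') {c : ℕ → ℝ}
    (hc : ExpDominated c) {Q Z : ℝ → Potential q Λ} (hQ : ∀ t, IsLocal (Q t))
    (hZ : ∀ t, IsLocal (Z t)) {m : ℕ} (hm : m ≠ 0) :
    ENNReal.ofReal |c m| * potNorm κ (fun t => (ad (Q t))^[m] (Z t)) ≤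
      (ENNReal.ofReal (4 * Real.exp (-κ) / (κ' - κ)) * potNorm κ' Q) ^ m * potNorm κ' Z := by
  have hm' : (0 : ℝ) < m := by exact_mod_cast Nat.pos_of_ne_zero hm
  have hδ : 0 < κ' - κ := sub_pos.2 hκ'
  -- The gap is shared equally among the $m$ commutators. The resulting $(m/e)^m$ is compensated by
  -- $|c_m|\le1/m!$.
  have h := potNorm_ad_iterate_le hκ le_rfl (ε := (κ' - κ) / m) (by positivity) hQ hZ m
  rw [show κ + m * ((κ' - κ) / m) = κ' by field_simp; ring] at h
  refine (mul_le_mul_right h _).trans ?_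
  rw [mul_pow, mul_pow, ← mul_assoc, ← mul_assoc]
  gcongr
  rw [← ENNReal.ofReal_pow (by positivity), ← ENNReal.ofReal_pow (by positivity),
    ← ENNReal.ofReal_mul (abs_nonneg _)]
  refine ENNReal.ofReal_le_ofReal ?_
  calc |c m| * (4 * Real.exp (-κ) * Real.exp (-1) / ((κ' - κ) / m)) ^ m
      ≤ (m.factorial : ℝ)⁻¹ * (4 * Real.exp (-κ) * Real.exp (-1) / ((κ' - κ) / m)) ^ m := by
        gcongr
        exact hc m
    _ = ((m.factorial : ℝ)⁻¹ * (Real.exp (-1) * m) ^ m) * (4 * Real.exp (-κ) / (κ' - κ)) ^ m := by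
        rw [mul_assoc ((m.factorial : ℝ)⁻¹), ← mul_pow]
        congr 2
        field_simp
    _ ≤ 1 * (4 * Real.exp (-κ) / (κ' - κ)) ^ m := by
        gcongr
        exact pow_div_factorial_mul_exp_le m
    _ = _ := one_mul _

/-- A power series in `ad_Q` without constant term is small when `Q` is. -/
lemma potNorm_adSeries_le {κ κ' : ℝ} (hκ : 0 ≤ κ) (hκ' : κ < κ') {c : ℕ → ℝ}
    (hc : ExpDominated c) (hc0 : c 0 = 0) {Q Z : ℝ → Potential q Λ} (hQ : ∀ t, IsLocal (Q t))
    (hZ : ∀ t, IsLocal (Z t)) {θ : ℝ} (hθ0 : 0 ≤ θ) (hθ : θ ≤ 1 / 9)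
    (h : ENNReal.ofReal (4 * Real.exp (-κ) / (κ' - κ)) * potNorm κ' Q ≤ ENNReal.ofReal θ) :
    potNorm κ (fun t => adSeries c (Q t) (Z t)) ≤ ENNReal.ofReal (9 / 8 * θ) * potNorm κ' Z := by
  have h1 : potNorm κ (fun t => adSeries c (Q t) (Z t)) ≤
      ∑' m, ENNReal.ofReal |c m| * potNorm κ (fun t => (ad (Q t))^[m] (Z t)) := by
    simp_rw [potNorm_eq_weightedSup, ← weightedSup_const_mul]
    refine le_trans (weightedSup_mono le_rfl fun S => iSup_le fun t => ?_)
      (weightedSup_tsum_le κ _)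
    beta_reduce
    rw [← (hasSum_adSeries_apply hc (Q t) (Z t) S).tsum_eq]
    refine (enorm_tsum_le _).trans (ENNReal.tsum_le_tsum fun m => ?_)
    refine (enorm_coe_smul (c m) ((ad (Q t))^[m] (Z t) S)).le.trans ?_
    exact mul_le_mul_right (enorm_le_supEnorm (fun t => (ad (Q t))^[m] (Z t)) t S) _
  refine h1.trans ?_
  rw [tsum_eq_zero_add' ENNReal.summable, hc0]
  simp only [abs_zero, ENNReal.ofReal_zero, zero_mul, zero_add]
  calc ∑' m, ENNReal.ofReal |c (m + 1)| * potNorm κ (fun t => (ad (Q t))^[m + 1] (Z t))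
      ≤ ∑' m : ℕ, ENNReal.ofReal θ ^ (m + 1) * potNorm κ' Z := by
        refine ENNReal.tsum_le_tsum fun m => ?_
        refine (potNorm_coeff_smul_ad_iterate_le hκ hκ' hc hQ hZ m.succ_ne_zero).trans ?_
        gcongr
    _ = ENNReal.ofReal (θ / (1 - θ)) * potNorm κ' Z := by
        rw [ENNReal.tsum_mul_right]
        congr 1
        simp_rw [← ENNReal.ofReal_pow hθ0, pow_succ']
        rw [← ENNReal.ofReal_tsum_of_nonneg (fun m => by positivity)
          ((summable_geometric_of_lt_one hθ0 (by linarith)).mul_left _), tsum_mul_left,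
          tsum_geometric_of_lt_one hθ0 (by linarith), div_eq_mul_inv]
    _ ≤ _ := by
        gcongr
        -- $1/(1-\theta)\le9/8$ because $\theta\le1/9$.
        rw [div_le_iff₀ (by linarith)]
        nlinarith

end PotNorm

/-! ### The exponential in a Banach algebra and Duhamel's formula -/

section BanachExp

open NormedSpace Filter Topology

variable {𝔸 : Type*} [NormedRing 𝔸] [NormedAlgebra ℂ 𝔸]

/-- The commutator with `a`, as a continuous linear map. -/
noncomputable def commCLM (a : 𝔸) : 𝔸 →L[ℂ] 𝔸 :=
  ContinuousLinearMap.mul ℂ 𝔸 a - (ContinuousLinearMap.mul ℂ 𝔸).flip a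

lemma commCLM_apply (a b : 𝔸) : commCLM a b = comm a b := rfl

/-- The integral in Duhamel's formula. -/
noncomputable def duhamel (x a b : 𝔸) : 𝔸 :=
  ∫ s in (0 : ℝ)..1, exp ((s : ℂ) • x) * b * exp ((1 - s : ℂ) • a)

lemma duhamel_smul (c : ℝ) (x a b : 𝔸) : duhamel x a (c • b) = c • duhamel x a b := by
  simp only [duhamel, ← intervalIntegral.integral_smul, mul_smul_comm, smul_mul_assoc]

variable [CompleteSpace 𝔸]

lemma exp_mul_exp_neg (a : 𝔸) : exp a * exp (-a) = 1 := by
  let _ := NormedAlgebra.restrictScalars ℚ ℂ 𝔸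
  rw [← exp_add_of_commute (Commute.refl a).neg_right, add_neg_cancel, exp_zero]

lemma exp_neg_mul_exp (a : 𝔸) : exp (-a) * exp a = 1 := by
  simpa using exp_mul_exp_neg (-a)

lemma continuous_exp' : Continuous (exp : 𝔸 → 𝔸) := by
  let _ := NormedAlgebra.restrictScalars ℚ ℂ 𝔸
  exact exp_continuous

lemma exp_smul_commCLM_apply (a b : 𝔸) (t : ℂ) :
    exp (t • commCLM a) b = exp (t • a) * b * exp (-(t • a)) := by
  have h1 : ∀ s : ℂ, HasDerivAt (fun s : ℂ => exp (s • (-a))) (exp (s • (-a)) * (-a)) s :=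
    fun s => hasDerivAt_exp_smul_const (-a) s
  have h2 : ∀ s : ℂ, HasDerivAt (fun s : ℂ => exp (s • a)) (a * exp (s • a)) s :=
    fun s => hasDerivAt_exp_smul_const' a s
  have h3 : ∀ s : ℂ, HasDerivAt (fun s : ℂ => exp (s • commCLM a) b)
      (comm a (exp (s • commCLM a) b)) s := fun s =>
    (ContinuousLinearMap.apply ℂ 𝔸 b).hasFDerivAt.comp_hasDerivAt s
      (hasDerivAt_exp_smul_const' (𝕂 := ℂ) (commCLM a) s)
  -- Undoing the conjugation gives a curve with zero derivative, hence constantly $b$.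
  let f : ℂ → 𝔸 := fun s => exp (s • (-a)) * exp (s • commCLM a) b * exp (s • a)
  have hf : ∀ s, HasDerivAt f 0 s := fun s => by
    refine (((h1 s).fun_mul (h3 s)).fun_mul (h2 s)).congr_deriv ?_
    simp only [comm]
    noncomm_ring
  have hconst := is_const_of_deriv_eq_zero (fun s => (hf s).differentiableAt)
    (fun s => (hf s).deriv) t 0
  have h0 : f 0 = b := by
    change exp ((0 : ℂ) • (-a)) * exp ((0 : ℂ) • commCLM a) b * exp ((0 : ℂ) • a) = b
    have h0 : (0 : ℂ) • commCLM a = 0 := zero_smul ℂ (commCLM a)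
    rw [h0, zero_smul, zero_smul, exp_zero, exp_zero, one_mul, mul_one]
    rfl
  rw [h0] at hconst
  conv_rhs => rw [← hconst]
  simp only [f, smul_neg]
  have e1 := exp_mul_exp_neg (t • a)
  calc exp (t • commCLM a) b
      = (exp (t • a) * exp (-(t • a))) * exp (t • commCLM a) b *
        (exp (t • a) * exp (-(t • a))) := by rw [e1, one_mul, mul_one]
    _ = _ := by noncomm_ring

lemma hasSum_exp_conj (a b : 𝔸) (t : ℂ) :
    HasSum (fun m : ℕ => ((m.factorial : ℂ)⁻¹ * t ^ m) • (comm a)^[m] b)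
      (exp (t • a) * b * exp (-(t • a))) := by
  rw [← exp_smul_commCLM_apply]
  have h := (exp_series_hasSum_exp' (𝕂 := ℂ) (t • commCLM a)).mapL
    (ContinuousLinearMap.apply ℂ 𝔸 b)
  have e : (fun m : ℕ => ((m.factorial : ℂ)⁻¹ * t ^ m) • (comm a)^[m] b) = fun m : ℕ =>
      (ContinuousLinearMap.apply ℂ 𝔸 b) ((m.factorial : ℂ)⁻¹ • (t • commCLM a) ^ m) := by
    funext m
    have hp : ((t • commCLM a) ^ m) b = t ^ m • (comm a)^[m] b := by
      induction m with
      | zero => simp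
      | succ m ih =>
        rw [pow_succ']
        change (t • commCLM a) (((t • commCLM a) ^ m) b) = _
        rw [ih, map_smul, Function.iterate_succ_apply', ← commCLM_apply, pow_succ, mul_smul]
        rfl
    rw [mul_smul, ← hp]
    rfl
  rw [e]
  exact h

lemma continuous_duhamel (a : 𝔸) : Continuous fun p : 𝔸 × 𝔸 => duhamel p.1 a p.2 := by
  refine intervalIntegral.continuous_parametric_intervalIntegral_of_continuous' ?_ 0 1
  have hc := continuous_exp' (𝔸 := 𝔸)
  refine Continuous.mul (Continuous.mul ?_ ?_) ?_
  · exact hc.comp (by fun_prop)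
  · fun_prop
  · exact hc.comp (by fun_prop)

/-- Integrate the derivative of $e^{sx}e^{(1-s)a}$ over $[0,1]$. -/
lemma exp_sub_exp_eq_duhamel (x a : 𝔸) : exp x - exp a = duhamel x a (x - a) := by
  have h1 : ∀ s : ℝ, HasDerivAt (fun s : ℝ => exp ((s : ℂ) • x)) (exp ((s : ℂ) • x) * x) s :=
    fun s => by
      refine ((hasDerivAt_exp_smul_const x (s : ℂ)).scomp s
        Complex.ofRealCLM.hasDerivAt).congr_deriv ?_
      simp
  have h2 : ∀ s : ℝ, HasDerivAt (fun s : ℝ => exp ((1 - s : ℂ) • a))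
      (-(a * exp ((1 - s : ℂ) • a))) s := fun s => by
    refine ((hasDerivAt_exp_smul_const' a (1 - s : ℂ)).scomp s
      (Complex.ofRealCLM.hasDerivAt.const_sub 1)).congr_deriv ?_
    simp
  have h := intervalIntegral.integral_eq_sub_of_hasDerivAt (a := 0) (b := 1)
    (fun s _ => (h1 s).fun_mul (h2 s)) ?_
  · simp only [Complex.ofReal_one, one_smul, sub_self, zero_smul, exp_zero, mul_one,
      Complex.ofReal_zero, one_mul, sub_zero] at h
    rw [← h, duhamel]
    refine intervalIntegral.integral_congr fun s _ => ?_
    noncomm_ring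
  · have hc := continuous_exp' (𝔸 := 𝔸)
    have c1 : Continuous fun s : ℝ => exp ((s : ℂ) • x) := hc.comp (by fun_prop)
    have c2 : Continuous fun s : ℝ => exp ((1 - s : ℂ) • a) := hc.comp (by fun_prop)
    exact Continuous.intervalIntegrable (by fun_prop) _ _

/-- The derivative of `exp` along a curve. -/
lemma hasDerivAt_exp_curve {a : ℝ → 𝔸} {b : 𝔸} {t : ℝ} (h : HasDerivAt a b t) :
    HasDerivAt (fun s => exp (a s)) (duhamel (a t) (a t) b) t := by
  rw [hasDerivAt_iff_tendsto_slope] at h ⊢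
  -- Duhamel's formula is exact for finite differences, so the limit only needs continuity of the
  -- integral.
  have e : slope (fun s => exp (a s)) t = fun s => duhamel (a s) (a t) (slope a t s) := by
    funext s
    simp only [slope, vsub_eq_sub, duhamel_smul, exp_sub_exp_eq_duhamel]
  rw [e]
  have h1 : Tendsto a (𝓝[≠] t) (𝓝 (a t)) := by
    have : ContinuousAt a t := (hasDerivAt_iff_tendsto_slope.2 h).continuousAt
    exact this.tendsto.mono_left nhdsWithin_le_nhds
  exact ((continuous_duhamel (a t)).tendsto (a t, b)).comp (h1.prodMk_nhds h)

lemma integral_ofReal_pow_complex (m : ℕ) :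
    ∫ s in (0 : ℝ)..1, ((s : ℂ) ^ m) = ((m : ℂ) + 1)⁻¹ := by
  have : ∀ s : ℝ, (s : ℂ) ^ m = ((s ^ m : ℝ) : ℂ) := fun s => by push_cast; rfl
  simp_rw [this]
  rw [intervalIntegral.integral_ofReal, integral_pow]
  push_cast
  simp

/-- The factor $e^{-a}$ turns the integrand into $e^{sa}be^{-sa}$. Integrating its series termwise
replaces $1/m!$ by $1/(m+1)!$, the coefficients of $(e^x-1)/x$. -/
lemma duhamel_self (a b : 𝔸) :
    HasSum (fun m : ℕ => (((m + 1).factorial : ℂ)⁻¹) • (comm a)^[m] b)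
      (duhamel a a b * exp (-a)) := by
  have h1 : duhamel a a b * exp (-a) =
      ∫ s in (0 : ℝ)..1, exp ((s : ℂ) • a) * b * exp (-((s : ℂ) • a)) := by
    have h := ((ContinuousLinearMap.mul ℝ 𝔸).flip (exp (-a))).intervalIntegral_comp_comm
      (μ := volume) (a := 0) (b := 1)
      (f := fun s : ℝ => exp ((s : ℂ) • a) * b * exp ((1 - s : ℂ) • a)) ?_
    · simp only [ContinuousLinearMap.flip_apply, ContinuousLinearMap.mul_apply'] at h
      rw [duhamel, ← h]
      refine intervalIntegral.integral_congr fun s _ => ?_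
      simp only [mul_assoc]
      congr 2
      let _ := NormedAlgebra.restrictScalars ℚ ℂ 𝔸
      rw [← exp_add_of_commute ((Commute.refl a).neg_right.smul_left _)]
      congr 1
      module
    · have hc := continuous_exp' (𝔸 := 𝔸)
      have c1 : Continuous fun s : ℝ => exp ((s : ℂ) • a) := hc.comp (by fun_prop)
      have c2 : Continuous fun s : ℝ => exp ((1 - s : ℂ) • a) := hc.comp (by fun_prop)
      exact Continuous.intervalIntegrable (by fun_prop) _ _
  rw [h1]
  have hs : ∀ s : ℝ, exp ((s : ℂ) • a) * b * exp (-((s : ℂ) • a)) =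
      ∑' m : ℕ, ((m.factorial : ℂ)⁻¹ * (s : ℂ) ^ m) • (comm a)^[m] b := fun s =>
    (hasSum_exp_conj a b s).tsum_eq.symm
  have hsum : Summable fun m : ℕ => ‖commCLM a‖ ^ m / m.factorial * ‖b‖ :=
    (Real.summable_pow_div_factorial _).mul_right _
  have h2 := intervalIntegral.hasSum_integral_of_dominated_convergence (μ := volume) (a := 0)
    (b := 1) (F := fun (m : ℕ) (s : ℝ) => ((m.factorial : ℂ)⁻¹ * (s : ℂ) ^ m) • (comm a)^[m] b)
    (f := fun s : ℝ => exp ((s : ℂ) • a) * b * exp (-((s : ℂ) • a)))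
    (fun m _ => ‖commCLM a‖ ^ m / m.factorial * ‖b‖)
    (fun m => Continuous.aestronglyMeasurable (by fun_prop)) ?_
    (Eventually.of_forall fun _ _ => hsum) (intervalIntegrable_const)
    (Eventually.of_forall fun s _ => hasSum_exp_conj a b s)
  · have e : (fun m : ℕ => (((m + 1).factorial : ℂ)⁻¹) • (comm a)^[m] b) = fun m : ℕ =>
        ∫ s in (0 : ℝ)..1, ((m.factorial : ℂ)⁻¹ * (s : ℂ) ^ m) • (comm a)^[m] b := by
      funext m
      rw [intervalIntegral.integral_smul_const, intervalIntegral.integral_const_mul,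
        integral_ofReal_pow_complex, Nat.factorial_succ]
      push_cast
      rw [mul_inv, mul_comm]
    rw [e]
    exact h2
  · refine fun m => Eventually.of_forall fun s hs => ?_
    rw [Set.uIoc_of_le zero_le_one] at hs
    have hb : ‖(comm a)^[m] b‖ ≤ ‖commCLM a‖ ^ m * ‖b‖ := by
      induction m with
      | zero => simp
      | succ m ih =>
        rw [Function.iterate_succ_apply', pow_succ', mul_assoc]
        exact ((commCLM a).le_opNorm _).trans (by gcongr)
    rw [norm_smul, norm_mul, norm_inv, norm_pow, Complex.norm_natCast, Complex.norm_real,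
      Real.norm_eq_abs, abs_of_pos hs.1]
    calc (m.factorial : ℝ)⁻¹ * s ^ m * ‖(comm a)^[m] b‖
        ≤ (m.factorial : ℝ)⁻¹ * 1 * (‖commCLM a‖ ^ m * ‖b‖) := by
          gcongr
          exact pow_le_one₀ hs.1.le hs.2
      _ = _ := by ring

end BanachExp

/-! ### Integral equations with measurable coefficients -/

section IntegralEquation

open NormedSpace Filter Topology

/-- An a.e. strongly measurable function with bounded norm. -/
structure IsBddMeas {E : Type*} [NormedAddCommGroup E] (f : ℝ → E) : Prop where
  meas : AEStronglyMeasurable f volume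
  bdd : ∃ M : ℝ, ∀ t, ‖f t‖ ≤ M

section

variable {E : Type*} [NormedAddCommGroup E]

lemma IsBddMeas.locallyIntegrable {f : ℝ → E} (hf : IsBddMeas f) :
    LocallyIntegrable f volume := by
  obtain ⟨M, hM⟩ := hf.bdd
  refine (locallyIntegrable_const M).mono hf.meas (Eventually.of_forall fun t => ?_)
  exact (hM t).trans (le_abs_self M)

lemma IsBddMeas.intervalIntegrable {f : ℝ → E} (hf : IsBddMeas f) (a b : ℝ) :
    IntervalIntegrable f volume a b :=
  (hf.locallyIntegrable.integrableOn_isCompact isCompact_uIcc).intervalIntegrable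

lemma IsBddMeas.locallyLipschitz_integral [NormedSpace ℝ E] {f : ℝ → E} (hf : IsBddMeas f) :
    LocallyLipschitz fun t : ℝ => ∫ s in (0 : ℝ)..t, f s := by
  obtain ⟨M, hM⟩ := hf.bdd
  have h0 : 0 ≤ M := (norm_nonneg _).trans (hM 0)
  refine (LipschitzWith.of_dist_le_mul (K := ⟨M, h0⟩) fun t s => ?_).locallyLipschitz
  rw [dist_eq_norm, intervalIntegral.integral_interval_sub_left (hf.intervalIntegrable _ _)
    (hf.intervalIntegrable _ _), Real.dist_eq]
  exact intervalIntegral.norm_integral_le_of_norm_le_const fun x _ => hM x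

end

variable {𝔸 : Type*} [NormedRing 𝔸]

lemma IsBddMeas.mul {f g : ℝ → 𝔸} (hf : IsBddMeas f) (hg : IsBddMeas g) :
    IsBddMeas fun t => f t * g t := by
  refine ⟨hf.meas.mul hg.meas, ?_⟩
  obtain ⟨M, hM⟩ := hf.bdd
  obtain ⟨N, hN⟩ := hg.bdd
  have h0 : 0 ≤ M := (norm_nonneg _).trans (hM 0)
  exact ⟨M * N, fun t => (norm_mul_le _ _).trans
    (mul_le_mul (hM t) (hN t) (norm_nonneg _) h0)⟩

variable [NormedAlgebra ℂ 𝔸]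

lemma LocallyLipschitz.mul_algebra {f g : ℝ → 𝔸} (hf : LocallyLipschitz f)
    (hg : LocallyLipschitz g) : LocallyLipschitz fun t => f t * g t := by
  have h : ContDiff ℂ 1 fun p : 𝔸 × 𝔸 => p.1 * p.2 := contDiff_fst.mul contDiff_snd
  exact h.locallyLipschitz.comp (hf.prodMk hg)

variable [CompleteSpace 𝔸]

lemma locallyLipschitz_exp : LocallyLipschitz (exp : 𝔸 → 𝔸) := by
  have h : ContDiff ℂ 1 (exp : 𝔸 → 𝔸) :=
    contDiff_iff_contDiffAt.2 fun x => (exp_analytic x).contDiffAt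
  exact h.locallyLipschitz

/-- On a compact interval such a function is Lipschitz, hence absolutely continuous. This replaces
the mean value theorem, as primitives of measurable functions are differentiable only almost
everywhere. -/
lemma eq_of_locallyLipschitz_of_ae_hasDerivAt_zero {E : Type*} [NormedAddCommGroup E]
    [NormedSpace ℝ E] {f : ℝ → E} (hf : LocallyLipschitz f)
    (h : ∀ᵐ t, HasDerivAt f 0 t) (t : ℝ) : f t = f 0 := by
  obtain ⟨K, hK⟩ := LocallyLipschitzOn.exists_lipschitzOnWith_of_compact
    (isCompact_uIcc (a := (0 : ℝ)) (b := t)) hf.locallyLipschitzOn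
  obtain ⟨C, hC⟩ := hK.absolutelyContinuousOnInterval.const_of_ae_hasDerivAt_zero
    (h.mono fun x hx _ => hx)
  rw [hC t Set.right_mem_uIcc, hC 0 Set.left_mem_uIcc]

/-- The integral equation satisfied by `e^{Q(t)} U(t)`. -/
lemma exp_mul_eq_integral {Q B H K U : ℝ → 𝔸} (hB : IsBddMeas B) (hH : IsBddMeas H)
    (hK : IsBddMeas K) (hQ : ∀ t, Q t = ∫ s in (0 : ℝ)..t, B s) (hUb : IsBddMeas U)
    (hU : ∀ t, U t = 1 - Complex.I • ∫ s in (0 : ℝ)..t, H s * U s)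
    (hW : IsBddMeas fun t => exp (Q t) * U t)
    (hrel : ∀ t, K t = exp (Q t) * H t * exp (-Q t) +
      Complex.I • (duhamel (Q t) (Q t) (B t) * exp (-Q t))) (t : ℝ) :
    exp (Q t) * U t = 1 - Complex.I • ∫ s in (0 : ℝ)..t, K s * (exp (Q s) * U s) := by
  let R : ℝ → 𝔸 := fun t => ∫ s in (0 : ℝ)..t, K s * (exp (Q s) * U s)
  have hQL : LocallyLipschitz Q := by
    have : Q = fun t => ∫ s in (0 : ℝ)..t, B s := funext hQ
    rw [this]
    exact hB.locallyLipschitz_integral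
  have smulL : ∀ {f : ℝ → 𝔸}, LocallyLipschitz f → LocallyLipschitz fun t => Complex.I • f t :=
    fun hf => ((lipschitzWith_smul Complex.I).locallyLipschitz).comp hf
  have hUL : LocallyLipschitz U := by
    have : U = fun t => 1 - Complex.I • ∫ s in (0 : ℝ)..t, H s * U s := funext hU
    rw [this]
    exact (LocallyLipschitz.const (1 : 𝔸)).sub (smulL (hH.mul hUb).locallyLipschitz_integral)
  have hRL : LocallyLipschitz R := (hK.mul hW).locallyLipschitz_integral
  -- The claim is $e^QU+iR=1$; it holds at $0$, and the left side has zero derivative almost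
  -- everywhere.
  have hF := eq_of_locallyLipschitz_of_ae_hasDerivAt_zero
    (f := fun t => exp (Q t) * U t + Complex.I • R t)
    ((LocallyLipschitz.mul_algebra (locallyLipschitz_exp.comp hQL) hUL).add (smulL hRL)) ?_ t
  · have hQ0 : Q 0 = 0 := by rw [hQ]; simp
    have hU0 : U 0 = 1 := by rw [hU]; simp
    have hR0 : R 0 = 0 := by simp [R]
    simp only [hQ0, hU0, hR0, exp_zero, mul_one, smul_zero, add_zero] at hF
    exact eq_sub_of_add_eq hF
  · filter_upwards [LocallyIntegrable.ae_hasDerivAt_integral hB.locallyIntegrable,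
      LocallyIntegrable.ae_hasDerivAt_integral (hH.mul hUb).locallyIntegrable,
      LocallyIntegrable.ae_hasDerivAt_integral (hK.mul hW).locallyIntegrable] with s h1 h2 h3
    have dQ : HasDerivAt Q (B s) s := (h1 0).congr_of_eventuallyEq (Eventually.of_forall hQ)
    have dU : HasDerivAt U (-(Complex.I • (H s * U s))) s :=
      (((h2 0).const_smul Complex.I).const_sub 1).congr_of_eventuallyEq (Eventually.of_forall hU)
    have dR : HasDerivAt (fun t => Complex.I • R t) (Complex.I • (K s * (exp (Q s) * U s))) s :=
      (h3 0).const_smul Complex.I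
    refine (((hasDerivAt_exp_curve dQ).fun_mul dU).fun_add dR).congr_deriv ?_
    rw [hrel]
    have e := exp_neg_mul_exp (Q s)
    have e1 : (exp (Q s) * H s * exp (-Q s) +
        Complex.I • (duhamel (Q s) (Q s) (B s) * exp (-Q s))) * (exp (Q s) * U s) =
        exp (Q s) * H s * U s + Complex.I • (duhamel (Q s) (Q s) (B s) * U s) := by
      rw [add_mul, smul_mul_assoc]
      congr 1
      · rw [mul_assoc (exp (Q s) * H s), ← mul_assoc (exp (-Q s)), e, one_mul]
      · rw [mul_assoc (duhamel _ _ _), ← mul_assoc (exp (-Q s)), e, one_mul]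
    rw [e1, smul_add, smul_smul, Complex.I_mul_I, mul_neg, mul_smul_comm, neg_one_smul]
    simp only [mul_assoc]
    abel

end IntegralEquation

/-! ### Uniform bounds and linearity of the commutator series -/

section Bracket

variable {ι 𝔸 : Type*} [Fintype ι] [NormedRing 𝔸] (r : ι → ι → ι → Prop)

/-- A crude bound that grows with the number of components. It serves only to show boundedness in
time, not the quantitative estimates. -/
lemma norm_bracketOn_le (Q Z : ι → 𝔸) :
    ‖bracketOn r Q Z‖ ≤ 2 * (Fintype.card ι : ℝ) ^ 2 * ‖Q‖ * ‖Z‖ := by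
  rw [pi_norm_le_iff_of_nonneg (by positivity)]
  intro k
  have h : ∀ i j, ‖comm (Q i) (Z j)‖ ≤ 2 * (‖Q‖ * ‖Z‖) := fun i j => by
    have h1 := norm_le_pi_norm Q i
    have h2 := norm_le_pi_norm Z j
    have h3 : ‖Q i‖ * ‖Z j‖ ≤ ‖Q‖ * ‖Z‖ := by gcongr
    refine (norm_sub_le _ _).trans ?_
    linarith [norm_mul_le (Q i) (Z j), norm_mul_le (Z j) (Q i)]
  classical
  calc ‖bracketOn r Q Z k‖ ≤ ∑ _i : ι, ∑ _j : ι, 2 * (‖Q‖ * ‖Z‖) := by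
        refine norm_sum_le_of_le _ fun i _ => norm_sum_le_of_le _ fun j _ => ?_
        split_ifs
        · exact h i j
        · rw [norm_zero]; positivity
    _ = _ := by
        simp only [Finset.sum_const, Finset.card_univ, nsmul_eq_mul]
        ring

variable [NormedAlgebra ℂ 𝔸]

lemma bracketOn_iterate_eq_pow (Q Z : ι → 𝔸) (m : ℕ) :
    (bracketOn r Q)^[m] Z = (bracketOnCLM r Q ^ m) Z := by
  induction m with
  | zero => rfl
  | succ m ih => rw [pow_succ', Function.iterate_succ_apply', ih]; rfl

variable [CompleteSpace 𝔸]

lemma exists_bound_bracketSeries {c : ℕ → ℝ} (hc : ExpDominated c) (M N : ℝ) :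
    ∃ B : ℝ, ∀ Q Z : ι → 𝔸, ‖Q‖ ≤ M → ‖Z‖ ≤ N → ‖bracketSeries r c Q Z‖ ≤ B := by
  set K : ℝ := 2 * (Fintype.card ι : ℝ) ^ 2 * |M| with hK
  have hK0 : 0 ≤ K := by positivity
  refine ⟨Real.exp K * |N|, fun Q Z hQ hZ => ?_⟩
  have hiter : ∀ m, ‖(bracketOn r Q)^[m] Z‖ ≤ K ^ m * |N| := fun m => by
    induction m with
    | zero => simpa using hZ.trans (le_abs_self N)
    | succ m ih =>
      rw [Function.iterate_succ_apply', pow_succ', mul_assoc]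
      refine (norm_bracketOn_le r Q _).trans ?_
      have h1 : 2 * (Fintype.card ι : ℝ) ^ 2 * ‖Q‖ ≤ K := by
        rw [hK]
        gcongr
        exact hQ.trans (le_abs_self M)
      exact mul_le_mul h1 ih (norm_nonneg _) hK0
  have hs : HasSum (fun m : ℕ => K ^ m / m.factorial * |N|) (Real.exp K * |N|) := by
    rw [Real.exp_eq_exp_ℝ]
    exact (NormedSpace.expSeries_div_hasSum_exp K).mul_right _
  refine (hasSum_bracketSeries r hc Q Z).norm_le_of_bounded hs fun m => ?_
  rw [norm_smul, Complex.norm_real, Real.norm_eq_abs, div_eq_inv_mul, mul_assoc]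
  exact mul_le_mul (hc m) (hiter m) (norm_nonneg _) (by positivity)

lemma bracketSeries_add {c : ℕ → ℝ} (hc : ExpDominated c) (Q Z Z' : ι → 𝔸) :
    bracketSeries r c Q (Z + Z') = bracketSeries r c Q Z + bracketSeries r c Q Z' := by
  refine (hasSum_bracketSeries r hc Q (Z + Z')).unique ?_
  have h := (hasSum_bracketSeries r hc Q Z).add (hasSum_bracketSeries r hc Q Z')
  simpa only [bracketOn_iterate_eq_pow, map_add, smul_add] using h

lemma bracketSeries_sub_coeff {c c' c'' : ℕ → ℝ} (hc : ExpDominated c) (hc' : ExpDominated c')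
    (hc'' : ExpDominated c'') (h : ∀ m, c'' m = c m - c' m) (Q Z : ι → 𝔸) :
    bracketSeries r c Q Z - bracketSeries r c' Q Z = bracketSeries r c'' Q Z := by
  refine HasSum.unique ((hasSum_bracketSeries r hc Q Z).sub (hasSum_bracketSeries r hc' Q Z)) ?_
  simpa only [h, Complex.ofReal_sub, sub_smul] using hasSum_bracketSeries r hc'' Q Z

end Bracket

/-- The coefficients of `exp` without the constant term. -/
noncomputable def expTail (m : ℕ) : ℝ := if m = 0 then 0 else (m.factorial : ℝ)⁻¹

/-- The coefficients of `(e^x - 1)/x`. -/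
noncomputable def phiCoeff (m : ℕ) : ℝ := ((m + 1).factorial : ℝ)⁻¹

/-- The coefficients of `e^x - (e^x - 1)/x`. -/
noncomputable def expSubPhi (m : ℕ) : ℝ := (m.factorial : ℝ)⁻¹ - ((m + 1).factorial : ℝ)⁻¹

lemma inv_factorial_succ_le (m : ℕ) : ((m + 1).factorial : ℝ)⁻¹ ≤ (m.factorial : ℝ)⁻¹ := by
  gcongr
  exact m.le_succ

lemma expDominated_expTail : ExpDominated expTail := fun m => by
  unfold expTail
  split_ifs
  · simp
  · exact expDominated_exp m

lemma expDominated_phiCoeff : ExpDominated phiCoeff := fun m => by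
  unfold phiCoeff
  rw [abs_of_nonneg (by positivity)]
  exact inv_factorial_succ_le m

lemma expDominated_expSubPhi : ExpDominated expSubPhi := fun m => by
  unfold expSubPhi
  rw [abs_of_nonneg (sub_nonneg.2 (inv_factorial_succ_le m))]
  have : 0 ≤ ((m + 1).factorial : ℝ)⁻¹ := by positivity
  linarith

lemma bracketSeries_exp_sub_self {ι 𝔸 : Type*} [Fintype ι] [NormedRing 𝔸] [NormedAlgebra ℂ 𝔸]
    [CompleteSpace 𝔸] (r : ι → ι → ι → Prop) (Q Z : ι → 𝔸) :
    bracketSeries r (fun m => (m.factorial : ℝ)⁻¹) Q Z - Z = bracketSeries r expTail Q Z := by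
  refine HasSum.unique ((hasSum_bracketSeries r expDominated_exp Q Z).sub (hasSum_ite_eq 0 Z)) ?_
  have h := hasSum_bracketSeries r expDominated_expTail Q Z
  refine (congrArg (fun f => HasSum f (bracketSeries r expTail Q Z)) (funext fun m => ?_)).mpr h
  cases m with
  | zero => simp [expTail]
  | succ m => simp [expTail]

/-! ### Means and primitives of bounded measurable functions -/

section Mean

variable {E : Type*} [NormedAddCommGroup E]

lemma isBddMeas_sub_const {f : ℝ → E} (hf : IsBddMeas f) (c : E) :
    IsBddMeas fun t => f t - c := by
  refine ⟨hf.meas.sub aestronglyMeasurable_const, ?_⟩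
  obtain ⟨M, hM⟩ := hf.bdd
  exact ⟨M + ‖c‖, fun t => (norm_sub_le _ _).trans (by linarith [hM t])⟩

variable [NormedSpace ℝ E]

lemma enorm_integral_le {f : ℝ → E} {T t : ℝ} (hT : 0 < T) (ht0 : 0 ≤ t) (ht : t ≤ T) :
    ‖∫ s in (0 : ℝ)..t, f s‖ₑ ≤ ENNReal.ofReal T * ⨆ s, ‖f s‖ₑ := by
  by_cases htop : ⨆ s, ‖f s‖ₑ = ∞
  · rw [htop, ENNReal.mul_top (by simpa using hT)]
    exact le_top
  set b := (⨆ s, ‖f s‖ₑ).toReal with hb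
  have hbd : ∀ s, ‖f s‖ ≤ b := fun s => by
    rw [hb, ← toReal_enorm]
    exact ENNReal.toReal_mono htop (le_iSup (fun s => ‖f s‖ₑ) s)
  rw [← ENNReal.ofReal_toReal htop, ← hb, ← ENNReal.ofReal_mul hT.le, ← ofReal_norm]
  refine ENNReal.ofReal_le_ofReal ?_
  refine (intervalIntegral.norm_integral_le_of_norm_le_const fun s _ => hbd s).trans ?_
  rw [sub_zero, abs_of_nonneg ht0, mul_comm]
  exact mul_le_mul_of_nonneg_right ht ENNReal.toReal_nonneg

lemma enorm_mean_le {f : ℝ → E} {T : ℝ} (hT : 0 < T) :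
    ‖(1 / T : ℝ) • ∫ s in (0 : ℝ)..T, f s‖ₑ ≤ ⨆ s, ‖f s‖ₑ := by
  rw [enorm_smul]
  calc ‖(1 / T : ℝ)‖ₑ * ‖∫ s in (0 : ℝ)..T, f s‖ₑ
      ≤ ENNReal.ofReal (1 / T) * (ENNReal.ofReal T * ⨆ s, ‖f s‖ₑ) := by
        refine mul_le_mul' (le_of_eq ?_) (enorm_integral_le hT hT.le le_rfl)
        rw [← ofReal_norm, Real.norm_of_nonneg (by positivity)]
    _ = _ := by
        rw [← mul_assoc, ← ENNReal.ofReal_mul (by positivity), one_div_mul_cancel hT.ne',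
          ENNReal.ofReal_one, one_mul]

lemma mean_sub_const [CompleteSpace E] {f : ℝ → E} {T : ℝ} (hT : 0 < T) (hf : IsBddMeas f) (c : E) :
    (1 / T : ℝ) • (∫ s in (0 : ℝ)..T, (f s - c)) =
      (1 / T : ℝ) • (∫ s in (0 : ℝ)..T, f s) - c := by
  rw [intervalIntegral.integral_sub (hf.intervalIntegrable _ _) intervalIntegrable_const,
    intervalIntegral.integral_const, smul_sub]
  congr 1
  simp [hT.ne', smul_smul]

lemma integral_sub_mean [CompleteSpace E] {f : ℝ → E} {T : ℝ} (hT : 0 < T) (hf : IsBddMeas f) :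
    ∫ s in (0 : ℝ)..T, (f s - (1 / T : ℝ) • ∫ u in (0 : ℝ)..T, f u) = 0 := by
  rw [intervalIntegral.integral_sub (hf.intervalIntegrable _ _) intervalIntegrable_const,
    intervalIntegral.integral_const, smul_smul, sub_zero, mul_one_div_cancel hT.ne', one_smul,
    sub_self]

lemma periodic_integral {f : ℝ → E} {T : ℝ} (hf : IsBddMeas f) (hp : Function.Periodic f T)
    (h0 : ∫ s in (0 : ℝ)..T, f s = 0) :
    Function.Periodic (fun t => ∫ s in (0 : ℝ)..t, f s) T := fun t => by
  have h := hp.intervalIntegral_add_eq_add 0 t (fun a b => hf.intervalIntegrable a b)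
  simpa [h0] using h

lemma aestronglyMeasurable_pi_of_forall {ι F : Type*} [Fintype ι] [NormedAddCommGroup F]
    {f : ℝ → ι → F} (h : ∀ i, AEStronglyMeasurable (fun t => f t i) volume) :
    AEStronglyMeasurable f volume := by
  classical
  have e : f = fun t => ∑ i, Pi.single (M := fun _ => F) i (f t i) :=
    funext fun t => (Finset.univ_sum_single (f t)).symm
  rw [e]
  refine Finset.aestronglyMeasurable_fun_sum _ fun i _ => ?_
  exact (continuous_single i).comp_aestronglyMeasurable (h i)

end Mean

/-! ### One change of frame -/

section Step

variable {d q : ℕ} {Λ : Finset (Fin d → ℤ)}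

lemma star_integral {𝔸 : Type*} [NormedRing 𝔸] [NormedAlgebra ℂ 𝔸] [StarRing 𝔸]
    [NormedStarGroup 𝔸] [StarModule ℂ 𝔸] [CompleteSpace 𝔸] (f : ℝ → 𝔸) (a b : ℝ)
    (hf : ∀ t, IsSelfAdjoint (f t)) : IsSelfAdjoint (∫ t in a..b, f t) := by
  let L : 𝔸 →L[ℝ] 𝔸 :=
    { toFun := star
      map_add' := star_add
      map_smul' := fun c x => by
        rw [← Complex.coe_smul, star_smul, Complex.star_def, Complex.conj_ofReal, Complex.coe_smul]
        rfl
      cont := continuous_star }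
  by_cases hi : IntervalIntegrable f volume a b
  · have h := L.intervalIntegral_comp_comm hi
    have e : ∀ t, L (f t) = f t := fun t => (hf t).star_eq
    simp only [e] at h
    exact h.symm
  · rw [intervalIntegral.integral_undef hi]
    exact IsSelfAdjoint.zero 𝔸

variable {T : ℝ} {H : ℝ → Potential q Λ}

lemma IsPeriodicHermitian.isBddMeas (hH : IsPeriodicHermitian T H) (S : ConnSet Λ) :
    IsBddMeas fun t => H t S :=
  ⟨hH.measurable S, hH.bounded.imp fun _ hM t => hM t S⟩

lemma isLocal_staticPart (hH : IsPeriodicHermitian T H) : IsLocal (staticPart T H) := by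
  intro S
  have h := intervalIntegral_mem_submodule (localOps q S.1) (fun t => hH.isLocal t S) 0 T
    ((hH.isBddMeas S).intervalIntegrable 0 T)
  have h2 := (localOps q S.1).smul_mem ((1 / T : ℝ) : ℂ) h
  exact h2

lemma isSelfAdjoint_staticPart (hH : IsPeriodicHermitian T H) (S : ConnSet Λ) :
    IsSelfAdjoint (staticPart T H S) := by
  have h := star_integral (fun t => H t S) 0 T (fun t => hH.hermitian t S)
  have h2 : IsSelfAdjoint (((1 / T : ℝ) : ℂ) • ∫ t in (0 : ℝ)..T, H t S) :=
    IsSelfAdjoint.smul (Complex.conj_ofReal _) h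
  exact h2

lemma IsPeriodicHermitian.drivePart (hH : IsPeriodicHermitian T H) :
    IsPeriodicHermitian T (drivePart T H) where
  isLocal t := (hH.isLocal t).sub (isLocal_staticPart hH)
  hermitian t S := by
    exact IsSelfAdjoint.sub (R := Op q Λ) (hH.hermitian t S) (isSelfAdjoint_staticPart hH S)
  periodic t := by
    funext S
    simp only [DrivenSpin.drivePart, hH.periodic t]
  measurable S := (isBddMeas_sub_const (hH.isBddMeas S) _).meas
  bounded := by
    obtain ⟨M, hM⟩ := hH.bounded
    refine ⟨M + ∑ S, ‖staticPart T H S‖, fun t S => (norm_sub_le _ _).trans ?_⟩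
    exact add_le_add (hM t S) (Finset.single_le_sum (f := fun S => ‖staticPart T H S‖)
      (fun _ _ => norm_nonneg _) (Finset.mem_univ S))

lemma integral_drivePart (hT : 0 < T) (hH : IsPeriodicHermitian T H) (S : ConnSet Λ) :
    ∫ t in (0 : ℝ)..T, drivePart T H t S = 0 :=
  integral_sub_mean hT (hH.isBddMeas S)

/-- The anti-Hermitian generator `A(t) = i ∫₀ᵗ V(s) ds`. -/
noncomputable def generator (T : ℝ) (H : ℝ → Potential q Λ) (t : ℝ) : Potential q Λ := fun S =>
  Complex.I • ∫ s in (0 : ℝ)..t, drivePart T H s S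

lemma generator_zero : generator T H 0 = 0 := by
  funext S
  unfold generator
  rw [intervalIntegral.integral_same]
  exact smul_zero (A := Op q Λ) Complex.I

lemma isLocal_generator (hH : IsPeriodicHermitian T H) (t : ℝ) : IsLocal (generator T H t) :=
  fun S => (localOps q S.1).smul_mem Complex.I
    (intervalIntegral_mem_submodule (localOps q S.1) (fun t => hH.drivePart.isLocal t S) 0 t
      ((hH.drivePart.isBddMeas S).intervalIntegrable 0 t))

lemma generator_mem_skewAdjoint (hH : IsPeriodicHermitian T H) (t : ℝ) (S : ConnSet Λ) :
    generator T H t S ∈ skewAdjoint (Op q Λ) := by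
  have h := star_integral (fun s => drivePart T H s S) 0 t (fun t => hH.drivePart.hermitian t S)
  exact h.smul_mem_skewAdjoint Complex.conj_I

lemma continuous_generator (hH : IsPeriodicHermitian T H) (S : ConnSet Λ) :
    Continuous fun t => generator T H t S :=
  ((hH.drivePart.isBddMeas S).locallyLipschitz_integral.continuous).const_smul Complex.I

lemma periodic_generator (hT : 0 < T) (hH : IsPeriodicHermitian T H) :
    Function.Periodic (generator T H) T := fun t => by
  funext S
  have h := periodic_integral (hH.drivePart.isBddMeas S)
    (fun t => congrFun (hH.drivePart.periodic t) S) (integral_drivePart hT hH S) t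
  exact congrArg (Complex.I • ·) h

/-- The potential of the Hamiltonian in the frame rotated by `e^{A(t)}`. -/
noncomputable def rotate (T : ℝ) (H : ℝ → Potential q Λ) (t : ℝ) : Potential q Λ :=
  expAd (generator T H t) (H t) - adSeries phiCoeff (generator T H t) (drivePart T H t)

/-- With $H=D+V$, the terms in $V$ combine to $e^x-(e^x-1)/x$, which vanishes at $x=0$: the drive
cancels to leading order. -/
lemma rotate_sub_staticPart (t : ℝ) :
    rotate T H t - staticPart T H = adSeries expTail (generator T H t) (staticPart T H) +
      adSeries expSubPhi (generator T H t) (drivePart T H t) := by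
  have e : H t = staticPart T H + drivePart T H t := by
    funext S
    simp [drivePart]
  unfold rotate
  rw [expAd_eq_adSeries]
  unfold adSeries
  conv_lhs => rw [e]
  rw [bracketSeries_add _ expDominated_exp, ← bracketSeries_exp_sub_self,
    ← bracketSeries_sub_coeff UnionEq expDominated_exp expDominated_phiCoeff
      expDominated_expSubPhi (fun m => rfl)]
  abel

lemma continuous_generator_pi (hH : IsPeriodicHermitian T H) : Continuous (generator T H) :=
  continuous_pi fun S => continuous_generator hH S

lemma exists_bound_adSeries (hT : 0 < T) (hH : IsPeriodicHermitian T H) {c : ℕ → ℝ}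
    (hc : ExpDominated c) {Z : ℝ → Potential q Λ} (hZ : ∃ M : ℝ, ∀ t S, ‖Z t S‖ ≤ M) :
    ∃ M : ℝ, ∀ t S, ‖adSeries c (generator T H t) (Z t) S‖ ≤ M := by
  obtain ⟨N, hN⟩ := hZ
  obtain ⟨M, hM⟩ : ∃ M, ∀ t, ‖generator T H t‖ ≤ M := by
    have hb := (isCompact_Icc (a := (0 : ℝ)) (b := T)).exists_bound_of_continuousOn
      (continuous_generator_pi hH).continuousOn
    obtain ⟨M, hM⟩ := hb
    refine ⟨M, fun t => ?_⟩
    obtain ⟨s, hs, hts⟩ := (periodic_generator hT hH).exists_mem_Ico₀ hT t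
    rw [hts]
    exact hM s ⟨hs.1, hs.2.le⟩
  obtain ⟨B, hB⟩ := exists_bound_bracketSeries (ι := ConnSet Λ) (𝔸 := Op q Λ) UnionEq hc M |N|
  refine ⟨B, fun t S => (norm_le_pi_norm _ S).trans (hB _ _ (hM t) ?_)⟩
  exact (pi_norm_le_iff_of_nonneg (abs_nonneg N)).2 fun S => (hN t S).trans (le_abs_self N)

lemma isPeriodicHermitian_rotate (hT : 0 < T) (hH : IsPeriodicHermitian T H) :
    IsPeriodicHermitian T (rotate T H) where
  isLocal t := by
    unfold rotate
    rw [expAd_eq_adSeries]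
    exact ((isLocal_generator hH t).adSeries expDominated_exp (hH.isLocal t)).sub
      ((isLocal_generator hH t).adSeries expDominated_phiCoeff (hH.drivePart.isLocal t))
  hermitian t S := by
    unfold rotate
    rw [expAd_eq_adSeries]
    exact (isSelfAdjoint_bracketSeries (𝔸 := Op q Λ) UnionEq expDominated_exp
        (generator_mem_skewAdjoint hH t) (hH.hermitian t) S).sub
      (isSelfAdjoint_bracketSeries (𝔸 := Op q Λ) UnionEq expDominated_phiCoeff
        (generator_mem_skewAdjoint hH t) (hH.drivePart.hermitian t) S)
  periodic t := by
    unfold rotate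
    rw [periodic_generator hT hH t, hH.periodic t, hH.drivePart.periodic t]
  measurable S := by
    have hA : AEStronglyMeasurable (generator T H) volume :=
      (continuous_generator_pi hH).aestronglyMeasurable
    have h1 := aestronglyMeasurable_bracketSeries (𝔸 := Op q Λ) UnionEq expDominated_exp hA
      (aestronglyMeasurable_pi_of_forall hH.measurable)
    have h2 := aestronglyMeasurable_bracketSeries (𝔸 := Op q Λ) UnionEq expDominated_phiCoeff hA
      (aestronglyMeasurable_pi_of_forall hH.drivePart.measurable)
    unfold rotate
    simp only [expAd_eq_adSeries]
    exact (continuous_apply S).comp_aestronglyMeasurable (h1.sub h2)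
  bounded := by
    obtain ⟨M, hM⟩ := exists_bound_adSeries hT hH expDominated_exp hH.bounded
    obtain ⟨N, hN⟩ := exists_bound_adSeries hT hH expDominated_phiCoeff hH.drivePart.bounded
    refine ⟨M + N, fun t S => ?_⟩
    unfold rotate
    rw [expAd_eq_adSeries]
    exact (norm_sub_le _ _).trans (add_le_add (hM t S) (hN t S))

end Step

/-! ### Unitaries in a rotated frame -/

section Unitary

open NormedSpace

lemma sum_smul_integral {ι E : Type*} [Fintype ι] [NormedAddCommGroup E] [NormedSpace ℂ E]
    {f : ι → ℝ → E} (hf : ∀ i, IsBddMeas (f i)) (t : ℝ) :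
    ∑ i, Complex.I • ∫ s in (0 : ℝ)..t, f i s = ∫ s in (0 : ℝ)..t, Complex.I • ∑ i, f i s := by
  rw [intervalIntegral.integral_smul, intervalIntegral.integral_finsetSum
    (fun i _ => (hf i).intervalIntegrable 0 t), Finset.smul_sum]

lemma isBddMeas_sum {ι E : Type*} [Fintype ι] [NormedAddCommGroup E]
    {f : ι → ℝ → E} (hf : ∀ i, IsBddMeas (f i)) : IsBddMeas fun t => ∑ i, f i t := by
  refine ⟨Finset.aestronglyMeasurable_fun_sum _ fun i _ => (hf i).meas, ?_⟩
  choose M hM using fun i => (hf i).bdd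
  exact ⟨∑ i, M i, fun t => norm_sum_le_of_le _ fun i _ => hM i t⟩

lemma IsBddMeas.const_smul {E : Type*} [NormedAddCommGroup E] [NormedSpace ℂ E]
    {f : ℝ → E} (hf : IsBddMeas f) (c : ℂ) : IsBddMeas fun t => c • f t := by
  refine ⟨hf.meas.const_smul c, ?_⟩
  obtain ⟨M, hM⟩ := hf.bdd
  exact ⟨‖c‖ * M, fun t => by rw [norm_smul]; gcongr; exact hM t⟩

variable {𝔸 : Type*} [NormedRing 𝔸] [NormedAlgebra ℂ 𝔸] [CompleteSpace 𝔸] [StarRing 𝔸]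
  [CStarRing 𝔸]

lemma exp_mem_unitary {a : 𝔸} (ha : a ∈ skewAdjoint 𝔸) : exp a ∈ unitary 𝔸 := by
  let _ := NormedAlgebra.restrictScalars ℚ ℂ 𝔸
  exact exp_mem_unitary_of_mem_skewAdjoint ha

lemma norm_le_one_of_mem_unitary {𝔸 : Type*} [NormedRing 𝔸] [StarRing 𝔸] [CStarRing 𝔸] {u : 𝔸}
    (hu : u ∈ unitary 𝔸) : ‖u‖ ≤ 1 := by
  rcases subsingleton_or_nontrivial 𝔸 with h | h
  · rw [Subsingleton.elim u 0, norm_zero]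
    exact zero_le_one
  · exact (CStarRing.norm_of_mem_unitary hu).le

/-- The Hamiltonian in a rotated frame generates the rotated unitaries. -/
lemma rotated_unitaries {Q B H K U : ℝ → 𝔸} (hB : IsBddMeas B) (hH : IsBddMeas H)
    (hK : IsBddMeas K) (hQ : ∀ t, Q t = ∫ s in (0 : ℝ)..t, B s)
    (hQc : Continuous Q) (hQs : ∀ t, Q t ∈ skewAdjoint 𝔸)
    (hUc : Continuous U) (hUu : ∀ t, U t ∈ unitary 𝔸)
    (hU : ∀ t, U t = 1 - Complex.I • ∫ s in (0 : ℝ)..t, H s * U s)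
    (hrel : ∀ t, K t = exp (Q t) * H t * exp (-Q t) +
      Complex.I • (duhamel (Q t) (Q t) (B t) * exp (-Q t))) :
    (Continuous fun t => exp (Q t) * U t) ∧ (∀ t, exp (Q t) * U t ∈ unitary 𝔸) ∧
      ∀ t, exp (Q t) * U t = 1 - Complex.I • ∫ s in (0 : ℝ)..t, K s * (exp (Q s) * U s) := by
  have hc : Continuous fun t => exp (Q t) * U t := (continuous_exp'.comp hQc).mul hUc
  have hu : ∀ t, exp (Q t) * U t ∈ unitary 𝔸 := fun t => mul_mem (exp_mem_unitary (hQs t)) (hUu t)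
  refine ⟨hc, hu, exp_mul_eq_integral hB hH hK hQ ?_ hU ?_ hrel⟩
  · exact ⟨hUc.aestronglyMeasurable, 1, fun t => norm_le_one_of_mem_unitary (hUu t)⟩
  · exact ⟨hc.aestronglyMeasurable, 1, fun t => norm_le_one_of_mem_unitary (hu t)⟩

end Unitary

lemma duhamel_complex_smul {𝔸 : Type*} [NormedRing 𝔸] [NormedAlgebra ℂ 𝔸] (c : ℂ) (x a b : 𝔸) :
    duhamel x a (c • b) = c • duhamel x a b := by
  simp only [duhamel, ← intervalIntegral.integral_smul, mul_smul_comm, smul_mul_assoc]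

/-- For $A'=iV$ this identifies $-\varphi(\mathrm{ad}_A)V$ with $i(e^A)'e^{-A}$, the term produced
by a moving frame. -/
lemma sub_duhamel_mul {𝔸 : Type*} [NormedRing 𝔸] [NormedAlgebra ℂ 𝔸] (x a b e : 𝔸) :
    x - duhamel a a b * e = x + Complex.I • (duhamel a a (Complex.I • b) * e) := by
  rw [duhamel_complex_smul, smul_mul_assoc, smul_smul, Complex.I_mul_I, neg_one_smul,
    sub_eq_add_neg]

/-! ### The rotated potential as an operator -/

section StepOperators

variable {d q : ℕ} {Λ : Finset (Fin d → ℤ)}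

lemma toOp_expAd {Q Z : Potential q Λ} (hQ : IsLocal Q) (hZ : IsLocal Z) :
    toOp (expAd Q Z) = NormedSpace.exp (toOp Q) * toOp Z * NormedSpace.exp (-toOp Q) := by
  rw [expAd_eq_adSeries]
  refine (hasSum_toOp_adSeries expDominated_exp hQ hZ).unique ?_
  have h := hasSum_exp_conj (toOp Q) (toOp Z) 1
  simpa using h

lemma toOp_adSeries_phi {Q Z : Potential q Λ} (hQ : IsLocal Q) (hZ : IsLocal Z) :
    toOp (adSeries phiCoeff Q Z) =
      duhamel (toOp Q) (toOp Q) (toOp Z) * NormedSpace.exp (-toOp Q) := by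
  refine (hasSum_toOp_adSeries expDominated_phiCoeff hQ hZ).unique ?_
  have h := duhamel_self (toOp Q) (toOp Z)
  simpa [phiCoeff] using h

lemma toOp_mem_skewAdjoint {Q : Potential q Λ} (hQ : ∀ S, Q S ∈ skewAdjoint (Op q Λ)) :
    toOp Q ∈ skewAdjoint (Op q Λ) := sum_mem fun S _ => hQ S

lemma toOp_sub (Z Z' : Potential q Λ) : toOp (Z - Z') = toOp Z - toOp Z' :=
  Finset.sum_sub_distrib _ _

lemma toOp_add (Z Z' : Potential q Λ) : toOp (Z + Z') = toOp Z + toOp Z' :=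
  Finset.sum_add_distrib

variable {T : ℝ} {H : ℝ → Potential q Λ}

lemma IsPeriodicHermitian.isBddMeas_toOp (hH : IsPeriodicHermitian T H) :
    IsBddMeas fun t => toOp (H t) := isBddMeas_sum fun S => hH.isBddMeas S

lemma toOp_generator (hH : IsPeriodicHermitian T H) (t : ℝ) :
    toOp (generator T H t) = ∫ s in (0 : ℝ)..t, Complex.I • toOp (drivePart T H s) :=
  sum_smul_integral (fun S => hH.drivePart.isBddMeas S) t

lemma continuous_toOp_generator (hH : IsPeriodicHermitian T H) :
    Continuous fun t => toOp (generator T H t) :=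
  continuous_finsetSum _ fun S _ => continuous_generator hH S

lemma toOp_rotate (hH : IsPeriodicHermitian T H) (t : ℝ) :
    toOp (rotate T H t) = NormedSpace.exp (toOp (generator T H t)) * toOp (H t) *
      NormedSpace.exp (-toOp (generator T H t)) + Complex.I •
        (duhamel (toOp (generator T H t)) (toOp (generator T H t))
          (Complex.I • toOp (drivePart T H t)) * NormedSpace.exp (-toOp (generator T H t))) := by
  unfold rotate
  rw [toOp_sub, toOp_expAd (isLocal_generator hH t) (hH.isLocal t),
    toOp_adSeries_phi (isLocal_generator hH t) (hH.drivePart.isLocal t)]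
  exact sub_duhamel_mul _ _ _ _

lemma IsGeneratedBy.rotate (hT : 0 < T) (hH : IsPeriodicHermitian T H) {U : ℝ → Op q Λ}
    (hU : IsGeneratedBy (fun t => toOp (H t)) U) :
    IsGeneratedBy (fun t => toOp (rotate T H t))
      fun t => NormedSpace.exp (toOp (generator T H t)) * U t := by
  obtain ⟨h1, h2, h3⟩ := rotated_unitaries (hH.drivePart.isBddMeas_toOp.const_smul Complex.I)
    hH.isBddMeas_toOp (isPeriodicHermitian_rotate hT hH).isBddMeas_toOp (toOp_generator hH)
    (continuous_toOp_generator hH)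
    (fun t => toOp_mem_skewAdjoint (generator_mem_skewAdjoint hH t)) hU.continuous hU.isUnitary
    hU.eq_integral (toOp_rotate hH)
  exact ⟨h1, h2, h3⟩

end StepOperators

/-! ### Norms after one change of frame -/

section StepNorms

variable {d q : ℕ} {Λ : Finset (Fin d → ℤ)} {T : ℝ} {H : ℝ → Potential q Λ}

lemma enorm_I_smul {E : Type*} [NormedAddCommGroup E] [NormedSpace ℂ E] (v : E) :
    ‖Complex.I • v‖ₑ = ‖v‖ₑ := by
  rw [enorm_smul, ← ofReal_norm Complex.I, Complex.norm_I, ENNReal.ofReal_one, one_mul]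

lemma potNorm_generator_le (hT : 0 < T) (hH : IsPeriodicHermitian T H) (κ : ℝ) :
    potNorm κ (generator T H) ≤ ENNReal.ofReal T * potNorm κ (drivePart T H) := by
  refine potNorm_le_const_mul fun t S => ?_
  obtain ⟨s, hs, hts⟩ := (periodic_generator hT hH).exists_mem_Ico₀ hT t
  rw [hts]
  exact (enorm_I_smul _).le.trans (enorm_integral_le hT hs.1 hs.2.le)

lemma potNorm_staticPart_sub_le (hT : 0 < T) (hH : IsPeriodicHermitian T H) (κ : ℝ)
    (D : Potential q Λ) :
    potNorm κ (fun _ => staticPart T H - D) ≤ potNorm κ (fun t => H t - D) := by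
  refine potNorm_mono le_rfl fun _ S => ?_
  have h1 : staticPart T H S - D S =
      (1 / T : ℝ) • (∫ s in (0 : ℝ)..T, (H s S - D S)) :=
    (mean_sub_const hT (hH.isBddMeas S) (D S)).symm
  have h2 := enorm_mean_le (f := fun s => H s S - D S) hT
  rw [← h1] at h2
  exact h2

/-- The drive is $H-D$ minus its mean, for any constant $D$. Taking for $D$ the static part before
the step shows that the new drive is small. -/
lemma potNorm_drivePart_le (hT : 0 < T) (hH : IsPeriodicHermitian T H) (κ : ℝ)
    (D : Potential q Λ) :
    potNorm κ (drivePart T H) ≤ 2 * potNorm κ (fun t => H t - D) := by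
  have e : drivePart T H = fun t => (H t - D) - (staticPart T H - D) := by
    funext t
    rw [sub_sub_sub_cancel_right]
    rfl
  rw [e, two_mul]
  exact (potNorm_sub_le κ _ _).trans (add_le_add le_rfl (potNorm_staticPart_sub_le hT hH κ D))

lemma potNorm_rotate_sub_le (hH : IsPeriodicHermitian T H) {κ κ' : ℝ} (hκ : 0 ≤ κ) (hκ' : κ < κ')
    {θ : ℝ} (hθ0 : 0 ≤ θ) (hθ : θ ≤ 1 / 9)
    (h : ENNReal.ofReal (4 * Real.exp (-κ) / (κ' - κ)) * potNorm κ' (generator T H) ≤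
      ENNReal.ofReal θ) :
    potNorm κ (fun t => rotate T H t - staticPart T H) ≤ ENNReal.ofReal (9 / 8 * θ) *
      (potNorm κ' (fun _ => staticPart T H) + potNorm κ' (drivePart T H)) := by
  simp only [rotate_sub_staticPart]
  refine (potNorm_add_le κ _ _).trans ?_
  rw [mul_add]
  exact add_le_add
    (potNorm_adSeries_le hκ hκ' expDominated_expTail (by simp [expTail]) (isLocal_generator hH)
      (fun _ => isLocal_staticPart hH) hθ0 hθ h)
    (potNorm_adSeries_le hκ hκ' expDominated_expSubPhi (by simp [expSubPhi])
      (isLocal_generator hH) hH.drivePart.isLocal hθ0 hθ h)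

lemma potNorm_expAd_sub_le {A Z : ℝ → Potential q Λ} (hA : ∀ t, IsLocal (A t))
    (hZ : ∀ t, IsLocal (Z t)) {κ κ' : ℝ} (hκ : 0 ≤ κ) (hκ' : κ < κ')
    {θ : ℝ} (hθ0 : 0 ≤ θ) (hθ : θ ≤ 1 / 9)
    (h : ENNReal.ofReal (4 * Real.exp (-κ) / (κ' - κ)) * potNorm κ' A ≤ ENNReal.ofReal θ) :
    potNorm κ (fun t => expAd (A t) (Z t) - Z t) ≤ ENNReal.ofReal (9 / 8 * θ) * potNorm κ' Z := by
  simp only [expAd_eq_adSeries, adSeries, bracketSeries_exp_sub_self]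
  exact potNorm_adSeries_le hκ hκ' expDominated_expTail (by simp [expTail]) hA hZ hθ0 hθ h

end StepNorms

/-! ### Decay rates and numerical constants -/

section Rates

/-- The decay rates along the iteration, interpolating between `κ₀` and `κ₀/(1 + ln (n + 1))` in
`n + 1` steps. -/
noncomputable def stepRate (κ₀ : ℝ) (n j : ℕ) : ℝ :=
  κ₀ / (1 + Real.log (1 + j * (n / (n + 1))))

/-- The loss factor `(j + 2)(1 + ln (j + 2))³` of the `j`-th step. -/
noncomputable def stepLoss (j : ℕ) : ℝ := (j + 2) * (1 + Real.log (j + 2)) ^ 3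

lemma stepRate_zero (κ₀ : ℝ) (n : ℕ) : stepRate κ₀ n 0 = κ₀ := by simp [stepRate]

lemma stepRate_last (κ₀ : ℝ) (n : ℕ) : stepRate κ₀ n (n + 1) = decayRate κ₀ n := by
  unfold stepRate decayRate
  -- $(n+1)\cdot n/(n+1)=n$, so $n+1$ steps end exactly at the required rate.
  congr 3
  push_cast
  field_simp
  ring

lemma stepLoss_pos (j : ℕ) : 0 < stepLoss j := by
  have : 0 ≤ Real.log ((j : ℝ) + 2) := Real.log_nonneg (by linarith [Nat.cast_nonneg (α := ℝ) j])
  unfold stepLoss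
  positivity

/-- The logarithms in consecutive rates differ by at least $1/(2(j+2))$, so
$(\kappa_j-\kappa_{j+1})\kappa_{j+1}$ is at least $\kappa_0^2$ over twice `stepLoss j`. The extra
$\kappa_{j+1}$ is the third logarithm in `stepLoss`; it is removed by $\kappa
e^{-\kappa}\le1/e\le3/8$, and $4\cdot\frac38\cdot2=3$. -/
lemma stepRate_step {κ₀ : ℝ} (hκ₀ : 0 < κ₀) {n : ℕ} (hn : 1 ≤ n) (j : ℕ) :
    0 < stepRate κ₀ n (j + 1) ∧ stepRate κ₀ n (j + 1) < stepRate κ₀ n j ∧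
      4 * Real.exp (-stepRate κ₀ n (j + 1)) / (stepRate κ₀ n j - stepRate κ₀ n (j + 1)) ≤
        3 * stepLoss j / κ₀ ^ 2 := by
  set θ : ℝ := n / (n + 1) with hθ
  have hn' : (1 : ℝ) ≤ n := by exact_mod_cast hn
  have hj : (0 : ℝ) ≤ j := Nat.cast_nonneg j
  have hθ1 : 1 / 2 ≤ θ := by
    rw [hθ, div_le_div_iff₀ (by norm_num) (by linarith)]
    linarith
  have hθ2 : θ ≤ 1 := by
    rw [hθ, div_le_one (by linarith)]
    linarith
  set y : ℝ := 1 + j * θ with hy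
  set y' : ℝ := 1 + (j + 1 : ℕ) * θ with hy'
  have hyy : y' = y + θ := by rw [hy', hy]; push_cast; ring
  have hy1 : 1 ≤ y := by rw [hy]; nlinarith
  have hy0 : 0 < y := by linarith
  have hy0' : 0 < y' := by linarith
  have hy2 : y' ≤ j + 2 := by rw [hy']; push_cast; nlinarith
  set L : ℝ := 1 + Real.log y with hL
  set L' : ℝ := 1 + Real.log y' with hL'
  set l : ℝ := 1 + Real.log (j + 2) with hl
  have hlog : 1 / (2 * (j + 2 : ℝ)) ≤ L' - L := by
    have h1 := Real.one_sub_inv_le_log_of_pos (div_pos hy0' hy0)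
    rw [Real.log_div hy0'.ne' hy0.ne', inv_div] at h1
    have h2 : 1 - y / y' = θ / y' := by
      field_simp
      linarith
    have h3 : 1 / (2 * (j + 2 : ℝ)) ≤ θ / y' := by
      rw [div_le_div_iff₀ (by positivity) hy0']
      nlinarith
    rw [hL, hL']
    linarith
  have hLpos : 1 ≤ L := by rw [hL]; linarith [Real.log_nonneg hy1]
  have hgap : 0 < 1 / (2 * (j + 2 : ℝ)) := by positivity
  have hLL : L < L' := by linarith
  have hLl : L' ≤ l := by rw [hL', hl]; linarith [Real.log_le_log hy0' hy2]
  have hr : stepRate κ₀ n j = κ₀ / L := rfl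
  have hr' : stepRate κ₀ n (j + 1) = κ₀ / L' := rfl
  have hL0 : 0 < L := by linarith
  have hL0' : 0 < L' := by linarith
  have hl0 : 0 < l := by linarith
  rw [hr, hr']
  have hpos : 0 < κ₀ / L' := by positivity
  have hlt : κ₀ / L' < κ₀ / L := by gcongr
  refine ⟨hpos, hlt, ?_⟩
  have hprod : κ₀ ^ 2 / (2 * stepLoss j) ≤ (κ₀ / L - κ₀ / L') * (κ₀ / L') := by
    have e : (κ₀ / L - κ₀ / L') * (κ₀ / L') = κ₀ ^ 2 * ((L' - L) / (L * L' * L')) := by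
      field_simp
    have e2 : κ₀ ^ 2 / (2 * stepLoss j) = κ₀ ^ 2 * ((1 / (2 * (j + 2 : ℝ))) / (l * l * l)) := by
      unfold stepLoss
      rw [← hl]
      field_simp
    rw [e, e2]
    gcongr
    linarith
  have hexp : (κ₀ / L') * Real.exp (-(κ₀ / L')) ≤ 3 / 8 := by
    refine (Real.mul_exp_neg_le_exp_neg_one _).trans ?_
    rw [Real.exp_neg, inv_le_comm₀ (Real.exp_pos 1) (by norm_num)]
    linarith [Real.exp_one_gt_d9]
  have hδ : 0 < κ₀ / L - κ₀ / L' := sub_pos.2 hlt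
  have hloss := stepLoss_pos j
  rw [div_le_iff₀ (by positivity)] at hprod
  rw [div_le_div_iff₀ hδ (by positivity)]
  have h4 : 4 * Real.exp (-(κ₀ / L')) * κ₀ ^ 2 ≤ 4 * Real.exp (-(κ₀ / L')) *
      ((κ₀ / L - κ₀ / L') * (κ₀ / L') * (2 * stepLoss j)) := by gcongr
  have h5 : 0 ≤ (κ₀ / L - κ₀ / L') * stepLoss j := by positivity
  nlinarith [mul_le_mul_of_nonneg_left hexp h5]

/-- As $j+2\le n+2\le x$, the logarithm is at most $\ln x$, and $(n+2)(1+\ln x)^3\le x$. This is the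
condition that $n_*$ is made for. -/
lemma stepLoss_le {x : ℝ} {n j : ℕ} (hx : 1 ≤ x) (hn : (n : ℝ) + 2 ≤ x / (1 + Real.log x) ^ 3)
    (hj : j ≤ n) : stepLoss j ≤ x := by
  have hl : 0 ≤ Real.log x := Real.log_nonneg hx
  have hp : 1 ≤ (1 + Real.log x) ^ 3 := one_le_pow₀ (by linarith)
  have hnx : (n : ℝ) + 2 ≤ x := hn.trans (div_le_self (by linarith) hp)
  have hj' : (j : ℝ) ≤ n := by exact_mod_cast hj
  have hj0 : (0 : ℝ) ≤ j := Nat.cast_nonneg j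
  rw [le_div_iff₀ (by positivity)] at hn
  refine le_trans ?_ hn
  unfold stepLoss
  have : 0 ≤ Real.log ((j : ℝ) + 2) := Real.log_nonneg (by linarith)
  gcongr
  linarith

lemma add_two_sq_le (j : ℕ) : ((j : ℝ) + 2) ^ 2 ≤ 4 * (9 / 4) ^ j := by
  induction j with
  | zero => norm_num
  | succ m ih =>
    have hm : (0 : ℝ) ≤ m := Nat.cast_nonneg m
    have h : ((m + 1 : ℕ) + 2 : ℝ) ^ 2 ≤ 9 / 4 * ((m : ℝ) + 2) ^ 2 := by
      push_cast
      nlinarith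
    calc ((m + 1 : ℕ) + 2 : ℝ) ^ 2 ≤ 9 / 4 * (4 * (9 / 4) ^ m) := by linarith
      _ = _ := by ring

/-- $1+\ln y\le3y^{1/3}$ reduces the loss to $27(j+2)^2$. The base $9/4$ is harmless since
$\frac94\cdot\frac{17}{64}=\frac{153}{256}<1$. -/
lemma stepLoss_le_pow (j : ℕ) : stepLoss j ≤ 108 * (9 / 4) ^ j := by
  have hj0 : (0 : ℝ) ≤ j := Nat.cast_nonneg j
  have hlog : 0 ≤ Real.log ((j : ℝ) + 2) := Real.log_nonneg (by linarith)
  have h1 : 1 + Real.log ((j : ℝ) + 2) ≤ 3 * Real.exp (Real.log ((j : ℝ) + 2) / 3) := by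
    linarith [Real.add_one_le_exp (Real.log ((j : ℝ) + 2) / 3)]
  have h2 : (1 + Real.log ((j : ℝ) + 2)) ^ 3 ≤ 27 * ((j : ℝ) + 2) := by
    calc (1 + Real.log ((j : ℝ) + 2)) ^ 3
        ≤ (3 * Real.exp (Real.log ((j : ℝ) + 2) / 3)) ^ 3 := by gcongr
      _ = 27 * Real.exp (Real.log ((j : ℝ) + 2)) := by
          rw [mul_pow, ← Real.exp_nat_mul]
          norm_num
          ring_nf
      _ = _ := by rw [Real.exp_log (by linarith)]
  have h3 := add_two_sq_le j
  unfold stepLoss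
  nlinarith

/-- The size of the `j`-th correction relative to the driving. -/
noncomputable def stepIncr (x : ℝ) (j : ℕ) : ℝ := 1 / 8 * (stepLoss j / x) * (17 / 64) ^ j

lemma stepIncr_nonneg {x : ℝ} (hx : 1 ≤ x) (j : ℕ) : 0 ≤ stepIncr x j := by
  have := stepLoss_pos j
  unfold stepIncr
  positivity

lemma sum_stepIncr_le {x : ℝ} (hx : 1 ≤ x) (m : ℕ) :
    ∑ j ∈ Finset.range m, stepIncr x j ≤ 36 / x := by
  have hx0 : 0 < x := by linarith
  calc ∑ j ∈ Finset.range m, stepIncr x j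
      ≤ ∑ j ∈ Finset.range m, (27 / 2) / x * (153 / 256) ^ j := by
        refine Finset.sum_le_sum fun j _ => ?_
        unfold stepIncr
        calc 1 / 8 * (stepLoss j / x) * (17 / 64) ^ j
            ≤ 1 / 8 * (108 * (9 / 4) ^ j / x) * (17 / 64) ^ j := by
              gcongr
              exact stepLoss_le_pow j
          _ = (27 / 2) / x * ((9 / 4) ^ j * (17 / 64) ^ j) := by ring
          _ = _ := by rw [← mul_pow]; norm_num
    _ = (27 / 2) / x * ∑ j ∈ Finset.range m, (153 / 256 : ℝ) ^ j := by rw [Finset.mul_sum]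
    -- The geometric sum is at most $256/103\le8/3$; this gives the constant $36$.
    _ ≤ (27 / 2) / x * (8 / 3) := by
        gcongr
        rw [geom_sum_eq (by norm_num), div_le_iff_of_neg (by norm_num)]
        have : (0 : ℝ) ≤ (153 / 256) ^ m := by positivity
        linarith
    _ = 36 / x := by ring

end Rates

/-! ### The iteration and its bounds -/

section Iteration

variable {d q : ℕ} {Λ : Finset (Fin d → ℤ)}

/-- The Hamiltonian after `j` successive changes of frame. -/
noncomputable def iterRotate (T : ℝ) (H : ℝ → Potential q Λ) : ℕ → ℝ → Potential q Λ
  | 0 => H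
  | j + 1 => rotate T (iterRotate T H j)

variable {T : ℝ} {H : ℝ → Potential q Λ}

lemma isPeriodicHermitian_iterRotate (hT : 0 < T) (hH : IsPeriodicHermitian T H) (j : ℕ) :
    IsPeriodicHermitian T (iterRotate T H j) := by
  induction j with
  | zero => exact hH
  | succ j ih => exact isPeriodicHermitian_rotate hT ih

lemma coeff_mul_potNorm_generator_le (hT : 0 < T) (hH : IsPeriodicHermitian T H) {κ κ' : ℝ}
    (hκ : κ < κ') {M r v : ℝ} (hv : 0 ≤ v)
    (hcoef : 4 * Real.exp (-κ) / (κ' - κ) * T ≤ r / (9 * M))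
    (hV : potNorm κ' (drivePart T H) ≤ ENNReal.ofReal v) :
    ENNReal.ofReal (4 * Real.exp (-κ) / (κ' - κ)) * potNorm κ' (generator T H) ≤
      ENNReal.ofReal (r * v / (9 * M)) := by
  have hδ : 0 < κ' - κ := sub_pos.2 hκ
  calc ENNReal.ofReal (4 * Real.exp (-κ) / (κ' - κ)) * potNorm κ' (generator T H)
      ≤ ENNReal.ofReal (4 * Real.exp (-κ) / (κ' - κ)) *
          (ENNReal.ofReal T * ENNReal.ofReal v) := by
        refine mul_le_mul_right ((potNorm_generator_le hT hH κ').trans ?_) _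
        exact mul_le_mul_right hV _
    _ = ENNReal.ofReal (4 * Real.exp (-κ) / (κ' - κ) * T * v) := by
        rw [← ENNReal.ofReal_mul hT.le, ← ENNReal.ofReal_mul (by positivity), mul_assoc]
    _ ≤ ENNReal.ofReal (r / (9 * M) * v) := by gcongr
    _ = _ := by rw [div_mul_eq_mul_div]

/-- The norms of the static and driving parts after `j` steps. -/
structure IterBound (κ₀ T x M v₀ : ℝ) (n : ℕ) (H : ℝ → Potential q Λ) (j : ℕ) (d v : ℝ) :
    Prop where
  static_nonneg : 0 ≤ d
  drive_nonneg : 0 ≤ v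
  static_le : potNorm (stepRate κ₀ n j) (fun _ => staticPart T (iterRotate T H j)) ≤
    ENNReal.ofReal d
  drive_le : potNorm (stepRate κ₀ n j) (drivePart T (iterRotate T H j)) ≤ ENNReal.ofReal v
  total_le : d + 2 * v ≤ M
  decay : v ≤ (1 / 4) ^ j * v₀
  static_sub_le : potNorm (stepRate κ₀ n j)
    (fun _ => staticPart T (iterRotate T H j) - staticPart T H) ≤
      ENNReal.ofReal ((∑ i ∈ Finset.range j, stepIncr x i) * v₀)

variable {κ₀ x M v₀ : ℝ} {n : ℕ}

lemma step_coeff_le (hT : 0 < T) (hκ₀ : 0 < κ₀) (hM : 0 < M) (hx : 1 ≤ x)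
    (hxM : x * (27 * T * M) = κ₀ ^ 2) (hn1 : 1 ≤ n) (j : ℕ) :
    4 * Real.exp (-stepRate κ₀ n (j + 1)) / (stepRate κ₀ n j - stepRate κ₀ n (j + 1)) * T ≤
      stepLoss j / x / (9 * M) := by
  refine (mul_le_mul_of_nonneg_right (stepRate_step hκ₀ hn1 j).2.2 hT.le).trans (le_of_eq ?_)
  rw [← hxM]
  have : 0 < x := by linarith
  field_simp
  ring

lemma IterBound.coeff_le (hT : 0 < T) (hH : IsPeriodicHermitian T H) (hκ₀ : 0 < κ₀) (hM : 0 < M)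
    (hx : 1 ≤ x) (hxM : x * (27 * T * M) = κ₀ ^ 2) (hn1 : 1 ≤ n) {j : ℕ} {d v : ℝ}
    (hb : IterBound κ₀ T x M v₀ n H j d v) :
    ENNReal.ofReal (4 * Real.exp (-stepRate κ₀ n (j + 1)) /
      (stepRate κ₀ n j - stepRate κ₀ n (j + 1))) *
        potNorm (stepRate κ₀ n j) (generator T (iterRotate T H j)) ≤
      ENNReal.ofReal (stepLoss j / x * v / (9 * M)) := by
  have hloss := stepLoss_pos j
  exact coeff_mul_potNorm_generator_le hT (isPeriodicHermitian_iterRotate hT hH j)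
    (stepRate_step hκ₀ hn1 j).2.1 hb.drive_nonneg
    (step_coeff_le hT hκ₀ hM hx hxM hn1 j) hb.drive_le

lemma IterBound.theta_le (hM : 0 < M) (hx : 1 ≤ x)
    (hn : (n : ℝ) + 2 ≤ x / (1 + Real.log x) ^ 3) {j : ℕ} (hj : j ≤ n) {d v : ℝ}
    (hb : IterBound κ₀ T x M v₀ n H j d v) :
    0 ≤ stepLoss j / x * v / (9 * M) ∧ stepLoss j / x * v / (9 * M) ≤ 1 / 9 ∧
      stepLoss j / x ≤ 1 := by
  have hloss := stepLoss_pos j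
  have hv := hb.drive_nonneg
  have h1 : stepLoss j / x ≤ 1 := by
    rw [div_le_one (by linarith)]
    exact stepLoss_le hx hn hj
  refine ⟨by positivity, ?_, h1⟩
  rw [div_le_iff₀ (by positivity)]
  have hvM : v ≤ M := by linarith [hb.total_le, hb.static_nonneg]
  calc stepLoss j / x * v ≤ 1 * v := by gcongr
    _ ≤ _ := by linarith

/-- With $r\le1$ the ratio of `stepLoss j` to $x$ and $\theta=rv/(9M)$, the remainder is at most
$\frac98\theta(d+v)\le w=rv/8$. The static part moves by at most $w$ and the drive is at most $2w\le
v/4$. As $5w\le2v$, the bound $d+2v\le M$ persists. -/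
lemma IterBound.succ (hT : 0 < T) (hH : IsPeriodicHermitian T H) (hκ₀ : 0 < κ₀) (hM : 0 < M)
    (hx : 1 ≤ x) (hxM : x * (27 * T * M) = κ₀ ^ 2) (hn1 : 1 ≤ n)
    (hn : (n : ℝ) + 2 ≤ x / (1 + Real.log x) ^ 3) {j : ℕ} (hj : j ≤ n) {d v : ℝ}
    (hb : IterBound κ₀ T x M v₀ n H j d v) :
    ∃ d' v', IterBound κ₀ T x M v₀ n H (j + 1) d' v' := by
  obtain ⟨hrate, hlt, -⟩ := stepRate_step hκ₀ hn1 j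
  obtain ⟨hθ0, hθ, hr⟩ := hb.theta_le hM hx hn hj
  have hP := isPeriodicHermitian_iterRotate hT hH j
  have hP' := isPeriodicHermitian_iterRotate hT hH (j + 1)
  have hd := hb.static_nonneg
  have hv := hb.drive_nonneg
  have hloss := stepLoss_pos j
  have hx0 : 0 < x := by linarith
  set r := stepLoss j / x with hrdef
  have hr0 : 0 ≤ r := by positivity
  set w := 1 / 8 * r * v with hw
  have hw0 : 0 ≤ w := by positivity
  have hW : potNorm (stepRate κ₀ n (j + 1))
      (fun t => iterRotate T H (j + 1) t - staticPart T (iterRotate T H j)) ≤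
        ENNReal.ofReal w := by
    refine (potNorm_rotate_sub_le hP hrate.le hlt hθ0 hθ
      (hb.coeff_le hT hH hκ₀ hM hx hxM hn1)).trans ?_
    refine (mul_le_mul_right (add_le_add hb.static_le hb.drive_le) _).trans ?_
    rw [← ENNReal.ofReal_add hd hv, ← ENNReal.ofReal_mul (by positivity)]
    refine ENNReal.ofReal_le_ofReal ?_
    have h1 : d + v ≤ M := by linarith [hb.total_le]
    calc 9 / 8 * (r * v / (9 * M)) * (d + v) ≤ 9 / 8 * (r * v / (9 * M)) * M := by gcongr
      _ = w := by rw [hw]; field_simp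
  have hD : potNorm (stepRate κ₀ n (j + 1)) (fun _ => staticPart T (iterRotate T H (j + 1)) -
      staticPart T (iterRotate T H j)) ≤ ENNReal.ofReal w :=
    (potNorm_staticPart_sub_le hT hP' _ _).trans hW
  have hrv : r * v ≤ v := by nlinarith
  refine ⟨d + w, 2 * w, by positivity, by positivity, ?_, ?_, ?_, ?_, ?_⟩
  · have e : (fun _ : ℝ => staticPart T (iterRotate T H (j + 1))) = fun t =>
        (fun _ : ℝ => staticPart T (iterRotate T H (j + 1)) - staticPart T (iterRotate T H j)) t +
          (fun _ : ℝ => staticPart T (iterRotate T H j)) t := by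
      funext t
      simp
    rw [e, add_comm d, ENNReal.ofReal_add hw0 hd]
    exact (potNorm_add_le _ _ _).trans
      (add_le_add hD ((potNorm_mono_rate hlt.le _).trans hb.static_le))
  · refine (potNorm_drivePart_le hT hP' _ (staticPart T (iterRotate T H j))).trans ?_
    rw [ENNReal.ofReal_mul (by norm_num), ENNReal.ofReal_ofNat]
    exact mul_le_mul_right hW _
  · rw [hw]
    linarith [hb.total_le]
  · rw [pow_succ, hw]
    linarith [hb.decay]
  · have e : (fun _ : ℝ => staticPart T (iterRotate T H (j + 1)) - staticPart T H) = fun t =>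
        (fun _ : ℝ => staticPart T (iterRotate T H (j + 1)) - staticPart T (iterRotate T H j)) t +
          (fun _ : ℝ => staticPart T (iterRotate T H j) - staticPart T H) t := by
      funext t
      simp
    -- The decay $1/4$ is relaxed to $17/64$ so that `stepIncr` also serves the conjugated
    -- potentials, which may grow by $17/16$ per step.
    have hinc : w ≤ stepIncr x j * v₀ := by
      have h1 : ((1 : ℝ) / 4) ^ j ≤ (17 / 64) ^ j :=
        pow_le_pow_left₀ (by norm_num) (by norm_num) j
      have hv₀ : 0 ≤ v₀ := by
        by_contra hneg
        have : ((1 : ℝ) / 4) ^ j * v₀ < 0 := mul_neg_of_pos_of_neg (by positivity) (not_le.1 hneg)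
        linarith [hb.decay]
      calc w = 1 / 8 * r * v := hw
        _ ≤ 1 / 8 * r * ((17 / 64) ^ j * v₀) := by
          gcongr
          exact hb.decay.trans (by gcongr)
        _ = stepIncr x j * v₀ := by unfold stepIncr; ring
    rw [e, Finset.sum_range_succ, add_mul]
    refine (potNorm_add_le _ _ _).trans ?_
    have hv₀w : 0 ≤ stepIncr x j * v₀ := hw0.trans hinc
    refine (add_le_add (hD.trans (ENNReal.ofReal_le_ofReal hinc))
      ((potNorm_mono_rate hlt.le _).trans hb.static_sub_le)).trans (le_of_eq ?_)
    rw [add_comm]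
    by_cases hv₀ : 0 ≤ v₀
    · rw [← ENNReal.ofReal_add _ hv₀w]
      exact mul_nonneg (Finset.sum_nonneg fun i _ => stepIncr_nonneg hx i) hv₀
    · exfalso
      have : ((1 : ℝ) / 4) ^ j * v₀ < 0 := mul_neg_of_pos_of_neg (by positivity) (not_le.1 hv₀)
      linarith [hb.decay]

lemma exists_iterBound (hT : 0 < T) (hH : IsPeriodicHermitian T H) (hκ₀ : 0 < κ₀)
    (hM : 0 < M) (hx : 1 ≤ x) (hxM : x * (27 * T * M) = κ₀ ^ 2) (hn1 : 1 ≤ n)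
    (hn : (n : ℝ) + 2 ≤ x / (1 + Real.log x) ^ 3) {d₀ : ℝ} (hd₀ : 0 ≤ d₀) (hv₀ : 0 ≤ v₀)
    (hD : potNorm κ₀ (fun _ => staticPart T H) ≤ ENNReal.ofReal d₀)
    (hV : potNorm κ₀ (drivePart T H) ≤ ENNReal.ofReal v₀) (hdv : d₀ + 2 * v₀ ≤ M) {j : ℕ}
    (hj : j ≤ n + 1) : ∃ d v, IterBound κ₀ T x M v₀ n H j d v := by
  induction j with
  | zero =>
    refine ⟨d₀, v₀, hd₀, hv₀, ?_, ?_, hdv, by simp, ?_⟩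
    · rw [stepRate_zero]; exact hD
    · rw [stepRate_zero]; exact hV
    -- The difference is zero; the comparison potential `H` is arbitrary.
    · refine (potNorm_le_const_mul (c := 0) (Z' := H) fun t S => ?_).trans ?_
      · have e : staticPart T (iterRotate T H 0) - staticPart T H = 0 := sub_self _
        rw [e, zero_mul]
        exact enorm_zero_le (E := Op q Λ) 0
      · rw [zero_mul]
        exact zero_le
  | succ j ih =>
    obtain ⟨d, v, hb⟩ := ih (by omega)
    exact hb.succ hT hH hκ₀ hM hx hxM hn1 hn (by omega)

/-- The potential `Z` conjugated successively by the generators of the first `j` steps. -/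
noncomputable def iterConj (A : ℕ → Potential q Λ) (Z : Potential q Λ) : ℕ → Potential q Λ
  | 0 => Z
  | j + 1 => expAd (A j) (iterConj A Z j)

lemma expAdProd_eq_iterConj (A : ℕ → Potential q Λ) (Z : Potential q Λ) (n : ℕ) :
    expAdProd A Z n = iterConj A Z (n + 1) := by
  induction n with
  | zero => rfl
  | succ n ih =>
    change expAd (A (n + 1)) (expAdProd A Z n) = _
    rw [ih]
    rfl

lemma isLocal_expAd {Q Z : Potential q Λ} (hQ : IsLocal Q) (hZ : IsLocal Z) :
    IsLocal (expAd Q Z) := by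
  rw [expAd_eq_adSeries]
  exact hQ.adSeries expDominated_exp hZ

lemma isLocal_iterConj {A : ℕ → Potential q Λ} (hA : ∀ j, IsLocal (A j)) {Z : Potential q Λ}
    (hZ : IsLocal Z) (j : ℕ) : IsLocal (iterConj A Z j) := by
  induction j with
  | zero => exact hZ
  | succ j ih => exact isLocal_expAd (hA j) ih

/-- The growth bound is proved together with the difference bound because the $j$-th increment is
proportional to the potential already conjugated. The decay $1/4$ of the drive dominates its growth
$17/16$. -/
lemma potNorm_iterConj_le (hT : 0 < T) (hH : IsPeriodicHermitian T H) (hκ₀ : 0 < κ₀)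
    (hM : 0 < M) (hx : 1 ≤ x) (hxM : x * (27 * T * M) = κ₀ ^ 2) (hn1 : 1 ≤ n)
    (hn : (n : ℝ) + 2 ≤ x / (1 + Real.log x) ^ 3) (hvM : 2 * v₀ ≤ M)
    (hbound : ∀ j ≤ n, ∃ d v, IterBound κ₀ T x M v₀ n H j d v)
    {Z : ℝ → Potential q Λ} (hZ : ∀ t, IsLocal (Z t)) {j : ℕ} (hj : j ≤ n + 1) :
    potNorm (stepRate κ₀ n j)
        (fun t => iterConj (fun i => generator T (iterRotate T H i) t) (Z t) j) ≤
      ENNReal.ofReal ((17 / 16) ^ j) * potNorm κ₀ Z ∧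
    potNorm (stepRate κ₀ n j)
        (fun t => iterConj (fun i => generator T (iterRotate T H i) t) (Z t) j - Z t) ≤
      ENNReal.ofReal (∑ i ∈ Finset.range j, stepIncr x i) * potNorm κ₀ Z := by
  induction j with
  | zero =>
    constructor
    · rw [stepRate_zero, pow_zero, ENNReal.ofReal_one, one_mul]
      exact le_rfl
    · refine (potNorm_le_const_mul (c := 0) (Z' := H) fun t S => ?_).trans ?_
      · have e : iterConj (fun i => generator T (iterRotate T H i) t) (Z t) 0 - Z t = 0 :=
          sub_self _
        rw [e, zero_mul]
        exact enorm_zero_le (E := Op q Λ) 0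
      · rw [zero_mul]
        exact zero_le
  | succ j ih =>
    have hjn : j ≤ n := by omega
    obtain ⟨ih1, ih2⟩ := ih (by omega)
    obtain ⟨d, v, hb⟩ := hbound j hjn
    obtain ⟨hrate, hlt, -⟩ := stepRate_step hκ₀ hn1 j
    obtain ⟨hθ0, hθ, hr⟩ := hb.theta_le hM hx hn hjn
    have hloss := stepLoss_pos j
    have hx0 : 0 < x := by linarith
    set Zj : ℝ → Potential q Λ :=
      fun t => iterConj (fun i => generator T (iterRotate T H i) t) (Z t) j with hZj
    have hA : ∀ i t, IsLocal (generator T (iterRotate T H i) t) := fun i t =>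
      isLocal_generator (isPeriodicHermitian_iterRotate hT hH i) t
    have hdiff := potNorm_expAd_sub_le (Z := Zj) (fun t => hA j t)
      (fun t => isLocal_iterConj (fun i => hA i t) (hZ t) j) hrate.le hlt hθ0 hθ
      (hb.coeff_le hT hH hκ₀ hM hx hxM hn1)
    -- From $v\le4^{-j}M/2$ the scale $M$ cancels, and $\frac98\cdot\frac1{18}=\frac1{16}$.
    have hcoef : 9 / 8 * (stepLoss j / x * v / (9 * M)) ≤
        1 / 16 * (stepLoss j / x) * (1 / 4) ^ j := by
      have h1 : v ≤ (1 / 4) ^ j * (M / 2) := hb.decay.trans (by gcongr; linarith)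
      calc 9 / 8 * (stepLoss j / x * v / (9 * M))
          ≤ 9 / 8 * (stepLoss j / x * ((1 / 4) ^ j * (M / 2)) / (9 * M)) := by gcongr
        _ = _ := by field_simp; norm_num
    have hinc : 1 / 16 * (stepLoss j / x) * (1 / 4) ^ j * (17 / 16) ^ j ≤ stepIncr x j := by
      unfold stepIncr
      rw [mul_assoc, ← mul_pow]
      have e : (1 / 4 * (17 / 16) : ℝ) = 17 / 64 := by norm_num
      rw [e]
      gcongr
      norm_num
    have hinc0 := stepIncr_nonneg hx j
    have hdiff1 : potNorm (stepRate κ₀ n (j + 1))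
        (fun t => expAd (generator T (iterRotate T H j) t) (Zj t) - Zj t) ≤
          ENNReal.ofReal (stepIncr x j) * potNorm κ₀ Z := by
      refine hdiff.trans ((mul_le_mul' (ENNReal.ofReal_le_ofReal hcoef) ih1).trans ?_)
      rw [← mul_assoc, ← ENNReal.ofReal_mul (by positivity)]
      gcongr
    have hdiff2 : potNorm (stepRate κ₀ n (j + 1))
        (fun t => expAd (generator T (iterRotate T H j) t) (Zj t) - Zj t) ≤
          ENNReal.ofReal (1 / 16 * (17 / 16) ^ j) * potNorm κ₀ Z := by
      refine hdiff.trans ((mul_le_mul' (ENNReal.ofReal_le_ofReal hcoef) ih1).trans ?_)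
      rw [← mul_assoc, ← ENNReal.ofReal_mul (by positivity)]
      gcongr
      calc 1 / 16 * (stepLoss j / x) * (1 / 4) ^ j ≤ 1 / 16 * 1 * 1 := by
            gcongr
            exact pow_le_one₀ (by norm_num) (by norm_num)
        _ = 1 / 16 := by norm_num
    constructor
    · have e : (fun t => iterConj (fun i => generator T (iterRotate T H i) t) (Z t) (j + 1)) =
          fun t => (fun t => expAd (generator T (iterRotate T H j) t) (Zj t) - Zj t) t +
            Zj t := by
        funext t
        rw [sub_add_cancel]
        rfl
      rw [e]
      refine (potNorm_add_le _ _ _).trans ((add_le_add hdiff2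
        ((potNorm_mono_rate hlt.le _).trans ih1)).trans (le_of_eq ?_))
      rw [← add_mul, ← ENNReal.ofReal_add (by positivity) (by positivity)]
      congr 2
      ring
    · have e : (fun t => iterConj (fun i => generator T (iterRotate T H i) t) (Z t) (j + 1) -
          Z t) = fun t => (fun t => expAd (generator T (iterRotate T H j) t) (Zj t) - Zj t) t +
            (fun t => Zj t - Z t) t := by
        funext t
        rw [sub_add_sub_cancel]
        rfl
      rw [e]
      refine (potNorm_add_le _ _ _).trans ((add_le_add hdiff1
        ((potNorm_mono_rate hlt.le _).trans ih2)).trans (le_of_eq ?_))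
      rw [← add_mul, ← ENNReal.ofReal_add hinc0
        (Finset.sum_nonneg fun i _ => stepIncr_nonneg hx i), Finset.sum_range_succ, add_comm]

end Iteration

/-! ### The composed frame -/

section Frame

lemma star_exp_of_mem_skewAdjoint {𝔸 : Type*} [NormedRing 𝔸] [StarRing 𝔸] [CStarRing 𝔸] {a : 𝔸}
    (ha : a ∈ skewAdjoint 𝔸) : star (NormedSpace.exp a) = NormedSpace.exp (-a) := by
  rw [NormedSpace.star_exp, skewAdjoint.mem_iff.1 ha]

variable {d q : ℕ} {Λ : Finset (Fin d → ℤ)}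

lemma expProd_mem_unitary {A : ℕ → Potential q Λ}
    (hA : ∀ j S, A j S ∈ skewAdjoint (Op q Λ)) (k : ℕ) : expProd A k ∈ unitary (Op q Λ) := by
  induction k with
  | zero => exact exp_mem_unitary (toOp_mem_skewAdjoint (hA 0))
  | succ k ih => exact mul_mem (exp_mem_unitary (toOp_mem_skewAdjoint (hA (k + 1)))) ih

lemma exp_toOp_zero : NormedSpace.exp (toOp (0 : Potential q Λ)) = 1 := by
  have h : toOp (0 : Potential q Λ) = 0 := Finset.sum_const_zero
  rw [h]
  exact NormedSpace.exp_zero (𝔸 := Op q Λ)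

lemma expProd_zero (k : ℕ) : expProd (fun _ => (0 : Potential q Λ)) k = 1 := by
  induction k with
  | zero => exact exp_toOp_zero
  | succ k ih =>
    change NormedSpace.exp (toOp (0 : Potential q Λ)) * expProd (fun _ => (0 : Potential q Λ)) k = 1
    rw [ih, exp_toOp_zero, mul_one]

lemma toOp_expAdProd {A : ℕ → Potential q Λ} (hA : ∀ j, IsLocal (A j))
    (hAs : ∀ j S, A j S ∈ skewAdjoint (Op q Λ)) {Z : Potential q Λ} (hZ : IsLocal Z) (k : ℕ) :
    toOp (expAdProd A Z k) = expProd A k * toOp Z * star (expProd A k) := by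
  induction k with
  | zero =>
    change toOp (expAd (A 0) Z) =
      NormedSpace.exp (toOp (A 0)) * toOp Z * star (NormedSpace.exp (toOp (A 0)))
    rw [toOp_expAd (hA 0) hZ, star_exp_of_mem_skewAdjoint (toOp_mem_skewAdjoint (hAs 0))]
  | succ k ih =>
    have hloc : IsLocal (expAdProd A Z k) := by
      rw [expAdProd_eq_iterConj]
      exact isLocal_iterConj hA hZ (k + 1)
    change toOp (expAd (A (k + 1)) (expAdProd A Z k)) =
      NormedSpace.exp (toOp (A (k + 1))) * expProd A k * toOp Z *
        star (NormedSpace.exp (toOp (A (k + 1))) * expProd A k)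
    rw [toOp_expAd (hA _) hloc, ih, star_mul,
      star_exp_of_mem_skewAdjoint (toOp_mem_skewAdjoint (hAs (k + 1)))]
    simp only [mul_assoc]

variable {T : ℝ} {H : ℝ → Potential q Λ}

lemma IsGeneratedBy.iterRotate (hT : 0 < T) (hH : IsPeriodicHermitian T H) {U : ℝ → Op q Λ}
    (hU : IsGeneratedBy (fun t => toOp (H t)) U) (k : ℕ) :
    IsGeneratedBy (fun t => toOp (iterRotate T H (k + 1) t))
      fun t => expProd (fun j => generator T (DrivenSpin.iterRotate T H j) t) k * U t := by
  induction k with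
  | zero => exact hU.rotate hT hH
  | succ k ih =>
    have h := ih.rotate hT (isPeriodicHermitian_iterRotate hT hH (k + 1))
    simp only [← mul_assoc] at h
    exact h

lemma toOp_staticPart_add_drivePart (t : ℝ) :
    toOp (staticPart T H) + toOp (drivePart T H t) = toOp (H t) := by
  rw [← toOp_add]
  congr 1
  funext S
  exact add_sub_cancel _ _

lemma potNorm_staticPart_lt_top (κ : ℝ) : potNorm κ (fun _ => staticPart T H) < ∞ :=
  potNorm_lt_top κ ⟨∑ S, ‖staticPart T H S‖, fun _ S =>
    Finset.single_le_sum (f := fun S => ‖staticPart T H S‖)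
      (fun _ _ => norm_nonneg _) (Finset.mem_univ S)⟩

end Frame

/-- If $\nu_0=0$, the quotient is $0$ by convention and `nStar` is $-2$, not a natural number. -/
lemma pos_of_eq_nStar {ν ν₀ : ℝ} {n : ℕ} (h0 : 0 ≤ ν₀) (hn : (n : ℤ) = nStar (ν / ν₀)) :
    0 < ν₀ := by
  refine h0.lt_of_ne' fun h => ?_
  rw [h, div_zero, nStar, zero_div, Int.floor_zero] at hn
  omega

lemma add_two_le_of_eq_nStar {x : ℝ} {n : ℕ} (hn : (n : ℤ) = nStar x) :
    (n : ℝ) + 2 ≤ x / (1 + Real.log x) ^ 3 := by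
  have h : ((n : ℤ) + 2 : ℤ) = ⌊x / (1 + Real.log x) ^ 3⌋ := by
    rw [hn, nStar]
    ring
  have h2 := Int.floor_le (x / (1 + Real.log x) ^ 3)
  rw [← h] at h2
  exact_mod_cast h2

/-- The $54\pi$ in $\nu_0$ is $27\cdot2\pi$, where $27=3\cdot9$: the $3$ of `stepRate_step` and the
threshold $\theta\le1/9$. -/
lemma frequency_ratio {T κ₀ M : ℝ} (hT : 0 < T) (hκ₀ : 0 < κ₀) (hM : 0 < M) :
    2 * Real.pi / T / (54 * Real.pi / κ₀ ^ 2 * M) * (27 * T * M) = κ₀ ^ 2 := by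
  have := Real.pi_pos
  field_simp
  norm_num

end DrivenSpin

theorem theorem1 :
    ∃ C : ℝ, 0 < C ∧
      ∀ (d q : ℕ) (Λ : Finset (Fin d → ℤ)) (T κ₀ ν ν₀ : ℝ) (n : ℕ) (H : ℝ → Potential q Λ),
        0 < T → 0 < κ₀ → IsPeriodicHermitian T H →
        ν = 2 * Real.pi / T → ν₀ = nuZero κ₀ T H → (n : ℤ) = nStar (ν / ν₀) →
        9 * Real.pi * (potNorm κ₀ (drivePart T H)).toReal / κ₀ ≤ ν → ν₀ ≤ ν → 1 ≤ n →
        ∃ (Dhat : Potential q Λ) (Vhat : ℝ → Potential q Λ) (A : ℕ → ℝ → Potential q Λ)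
          (Y : ℝ → Op q Λ),
          -- the effective static and driving potentials
          IsLocal Dhat ∧ (∀ S, IsSelfAdjoint (Dhat S)) ∧ IsPeriodicHermitian T Vhat ∧
          -- the generators `A_j` and the unitaries `Y(t) = e^{A_n(t)} ⋯ e^{A_0(t)}`
          (∀ j ≤ n, (∀ t, IsLocal (A j t)) ∧ (∀ t S, A j t S ∈ skewAdjoint (Op q Λ)) ∧
            (∀ S, Continuous fun t => A j t S) ∧ Function.Periodic (A j) T ∧ A j 0 = 0) ∧
          (∀ t, Y t = expProd (fun j => A j t) n) ∧
          (∀ t, Y t ∈ unitary (Op q Λ)) ∧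
          Function.Periodic Y T ∧ (∀ m : ℤ, Y (m * T) = 1) ∧
          -- `Y U` is generated by `Dhat + Vhat`
          (∀ U : ℝ → Op q Λ, IsGeneratedBy (fun t => toOp (H t)) U →
            IsGeneratedBy (fun t => toOp Dhat + toOp (Vhat t)) fun t => Y t * U t) ∧
          -- the bounds on the potentials
          potNorm (decayRate κ₀ n) (fun _ => Dhat - staticPart T H) ≤
            ENNReal.ofReal (C * (ν₀ / ν)) * potNorm κ₀ (drivePart T H) ∧
          potNorm (decayRate κ₀ n) Vhat ≤
            ENNReal.ofReal (C * (2 / 3) ^ n) * potNorm κ₀ (drivePart T H) ∧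
          -- `Y` is quasilocal and close to the identity
          (∀ Z : ℝ → Potential q Λ, (∀ t, IsLocal (Z t)) →
            (∀ t, IsLocal (expAdProd (fun j => A j t) (Z t) n) ∧
              toOp (expAdProd (fun j => A j t) (Z t) n) = Y t * toOp (Z t) * star (Y t)) ∧
            potNorm (decayRate κ₀ n) (fun t => expAdProd (fun j => A j t) (Z t) n - Z t) ≤
              ENNReal.ofReal (C * (ν₀ / ν)) * potNorm κ₀ Z) := by
  
  -- The value comes from `sum_stepIncr_le`; the bound on the drive would hold with $1$.
  refine ⟨36, by norm_num, ?_⟩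
  intro d q Λ T κ₀ ν ν₀ n H hT hκ₀ hH hν hν₀ hn _ hle hn1
  set d₀ := (potNorm κ₀ fun _ => staticPart T H).toReal
  set v₀ := (potNorm κ₀ (drivePart T H)).toReal
  have hd₀0 : 0 ≤ d₀ := ENNReal.toReal_nonneg
  have hv₀0 : 0 ≤ v₀ := ENNReal.toReal_nonneg
  have hDn : potNorm κ₀ (fun _ => staticPart T H) = ENNReal.ofReal d₀ :=
    (ENNReal.ofReal_toReal (potNorm_staticPart_lt_top κ₀).ne).symm
  have hVn : potNorm κ₀ (drivePart T H) = ENNReal.ofReal v₀ :=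
    (ENNReal.ofReal_toReal (potNorm_lt_top κ₀ hH.drivePart.bounded).ne).symm
  have hpi := Real.pi_pos
  have hν₀M : ν₀ = 54 * Real.pi / κ₀ ^ 2 * (d₀ + 2 * v₀) := hν₀
  clear_value d₀ v₀
  have hν₀pos : 0 < ν₀ := by
    refine pos_of_eq_nStar ?_ hn
    rw [hν₀M]
    positivity
  have hM : 0 < d₀ + 2 * v₀ := by
    rw [hν₀M] at hν₀pos
    exact pos_of_mul_pos_right hν₀pos (by positivity)
  have hx : 1 ≤ ν / ν₀ := (one_le_div hν₀pos).2 hle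
  have hxM : ν / ν₀ * (27 * T * (d₀ + 2 * v₀)) = κ₀ ^ 2 := by
    rw [hν, hν₀M]
    exact frequency_ratio hT hκ₀ hM
  have hn2 := add_two_le_of_eq_nStar hn
  have hsum : ∀ m, ∑ i ∈ Finset.range m, stepIncr (ν / ν₀) i ≤ 36 * (ν₀ / ν) := fun m =>
    (sum_stepIncr_le hx m).trans_eq (by rw [div_div_eq_mul_div, mul_div_assoc])
  have hbound : ∀ j ≤ n + 1, ∃ d v, IterBound κ₀ T (ν / ν₀) (d₀ + 2 * v₀) v₀ n H j d v :=
    fun j hj => exists_iterBound hT hH hκ₀ hM hx hxM hn1 hn2 hd₀0 hv₀0 hDn.le hVn.le le_rfl hj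
  have hP := isPeriodicHermitian_iterRotate hT hH
  have hA : ∀ t j, IsLocal (generator T (iterRotate T H j) t) := fun t j =>
    isLocal_generator (hP j) t
  have hAs : ∀ t j S, generator T (iterRotate T H j) t S ∈ skewAdjoint (Op q Λ) := fun t j =>
    generator_mem_skewAdjoint (hP j) t
  have hper : ∀ j, Function.Periodic (generator T (iterRotate T H j)) T := fun j =>
    periodic_generator hT (hP j)
  obtain ⟨d', v', hb⟩ := hbound (n + 1) le_rfl
  -- The generators $A_0,\dots,A_n$ are $n+1$ in number, so all final bounds are read off at step
  -- $n+1$.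
  rw [hVn, ← stepRate_last]
  refine ⟨staticPart T (iterRotate T H (n + 1)), drivePart T (iterRotate T H (n + 1)),
    fun j t => generator T (iterRotate T H j) t,
    fun t => expProd (fun j => generator T (iterRotate T H j) t) n,
    isLocal_staticPart (hP _), isSelfAdjoint_staticPart (hP _), (hP _).drivePart,
    fun j _ => ⟨fun t => hA t j, fun t => hAs t j, continuous_generator (hP j), hper j,
      generator_zero⟩, fun _ => rfl, fun t => expProd_mem_unitary (hAs t) n, fun t => ?_,
    fun m => ?_, fun U hU => ?_, ?_, ?_, fun Z hZ => ⟨fun t => ⟨?_, ?_⟩, ?_⟩⟩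
  · exact congrArg (expProd · n) (funext fun j => hper j t)
  -- Periodicity carries the vanishing of every generator at time $0$ to all multiples of $T$.
  · have e : (fun j => generator T (iterRotate T H j) (m * T)) = fun _ => 0 := by
      funext j
      have h := (hper j).int_mul m 0
      rw [zero_add, generator_zero] at h
      exact h
    beta_reduce
    rw [e, expProd_zero]
  · have h := hU.iterRotate hT hH n
    simp only [← toOp_staticPart_add_drivePart (H := iterRotate T H (n + 1)) (T := T)] at h
    exact h
  · refine hb.static_sub_le.trans ?_
    rw [← ENNReal.ofReal_mul' hv₀0]
    gcongr
    exact hsum _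
  · refine hb.drive_le.trans ?_
    rw [← ENNReal.ofReal_mul' hv₀0]
    refine ENNReal.ofReal_le_ofReal (hb.decay.trans ?_)
    gcongr
    calc ((1 : ℝ) / 4) ^ (n + 1) ≤ (1 / 4) ^ n :=
          pow_le_pow_of_le_one (by norm_num) (by norm_num) n.le_succ
      _ ≤ (2 / 3) ^ n := pow_le_pow_left₀ (by norm_num) (by norm_num) n
      _ ≤ 36 * (2 / 3) ^ n := le_mul_of_one_le_left (by positivity) (by norm_num)
  · rw [expAdProd_eq_iterConj]
    exact isLocal_iterConj (hA t) (hZ t) _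
  · exact toOp_expAdProd (hA t) (hAs t) (hZ t) n
  · simp only [expAdProd_eq_iterConj]
    refine (potNorm_iterConj_le hT hH hκ₀ hM hx hxM hn1 hn2 (by linarith)
      (fun j hj => hbound j (by omega)) hZ le_rfl).2.trans ?_
    gcongr
    exact hsum _
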